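/- Let $t_1,t_2,t_3,t_4\in\mathbb C\subset\mathbb P^1$ be four distinct points, $D=t_1+t_2+t_3+t_4$, and let $x$ be the coordinate on $\mathbb P^1=\mathbb P^1_{\mathbb C}$. Let ${\bf r}=(r_i^{+},r_i^{-})_{1\le i\le 4}$ be complex numbers with $\sum_{i=1}^4(r_i^++r_i^-)+1=0$ that are nonspecial, i.e. $r_1^{\sigma_1}+r_2^{\sigma_2}+r_3^{\sigma_3}+r_4^{\sigma_4}\notin\mathbb Z$ for all $\sigma_1,\dots,\sigma_4\in\{+,-\}$, and $r_i^+-r_i^-\notin\mathbb Z$ for all $i$. Let $E$ be a vector bundle of rank $2$ and degree $1$ on $\mathbb P^1$ with a quasi-parabolic structure $P_\bullet$, that is, lines $P_i\subset E_{t_i}$ for $i=1,\dots,4$. Put $B=\mathcal O\oplus\mathcal O(1)$, let $e$ be the unit section of $\mathcal O$ and $f$ the section of $\mathcal O(1)$ vanishing (only) at $\infty$. A line in $B_{t_i}$ has a coordinate $u\in\mathbb C\cup\{\infty\}$: it is spanned by $e(t_i)+u f(t_i)$ if $u\neq\infty$ and by $f(t_i)$ if $u=\infty$. A line $L\subset B_{t_i}$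 also determines a point $U=\tilde L^{\perp}$ of the projective plane $\mathbb P^2$ of lines in $H^0(B)^*=\mathbb C\oplus H^0(\mathcal O(1))^*$, where $\tilde L\subset H^0(B)$ is the $2$-dimensional space of sections whose value at $t_i$ lies in $L$; the origin of $\mathbb P^2$ is the point $\mathbb C\oplus 0$. The point $U$ lies on the line $T_i\subset\mathbb P^2$ through the origin that consists of the points orthogonal to all sections of $\mathcal O(1)$ vanishing at $t_i$. Then the following conditions are equivalent: 1. there is a logarithmic connection $\nabla:E\to E\otimes\Omega^1_{\mathbb P^1}(\log D)$ whose residue at each $t_i$ preserves $P_i$, acts by $r_i^-$ on $P_i$ and by $r_i^+$ on $E_{t_i}/P_i$; 2. $(E,P_\bullet)$ is indecomposable, i.e. not the direct sum of two nonzero quasi-parabolic bundles; 3. $(E,P_\bullet)$ is simple, i.e. the only endomorphisms of $E$ preserving all the $P_i$ are the scalars; 4. $E\cong B$ and, for the coordinates $u_i$ of the quasi-parabolic structure obtained on $B$ through some such isomorphism, there is at most one $i$ with $u_i=\infty$, and the lines $P_i$ with $u_i\neq\infty$ are not all contained in a single subbundle of $B$ isomorphic to $\mathcal O$; 5. $E\cong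 B$ and, through some such isomorphism, there are among the points $U_1,\dots,U_4\in\mathbb P^2$ corresponding to $P_1,\dots,P_4$ three non-colinear points distinct from the origin. -/

import Mathlib

open scoped OnePoint LinearAlgebra.Projectivization

noncomputable section

namespace P1

/-! ### The projective line: function field, standard charts, the derivation `d/dx` -/

/-- The function field `ℂ(x)` of the projective line. -/
abbrev K : Type := RatFunc ℂ

/-- The coordinate `x`. -/
abbrev x : K := RatFunc.X

/-- The functions on the chart `x ≠ ∞`, the ring `ℂ[x]` inside `ℂ(x)`. -/
abbrev O₀ : Subalgebra ℂ K := Algebra.adjoin ℂ {x}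

/-- The functions on the chart `x ≠ 0`, the ring `ℂ[x⁻¹]` inside `ℂ(x)`. -/
abbrev Oinf : Subalgebra ℂ K := Algebra.adjoin ℂ {x⁻¹}

/-- The function `x - c`. -/
def xSub (c : ℂ) : K := x - algebraMap ℂ K c

theorem xSub_mem (c : ℂ) : xSub c ∈ O₀ :=
  sub_mem (Algebra.subset_adjoin rfl) (O₀.algebraMap_mem c)

/-- `d/dx` on rational functions, by the quotient rule. -/
def ddxFun (a : K) : K :=
  (algebraMap (Polynomial ℂ) K
      (Polynomial.derivative a.num * a.denom - a.num * Polynomial.derivative a.denom))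
    / algebraMap (Polynomial ℂ) K a.denom ^ 2

theorem quotient_rule_aux (n d p q : Polynomial ℂ) (h1 : n * q = p * d) :
    (Polynomial.derivative n * d - n * Polynomial.derivative d) * q ^ 2 =
      (Polynomial.derivative p * q - p * Polynomial.derivative q) * d ^ 2 := by
  have h2 := congrArg Polynomial.derivative h1
  rw [Polynomial.derivative_mul, Polynomial.derivative_mul] at h2
  linear_combination (q * d) * h2 -
    (Polynomial.derivative d * q + d * Polynomial.derivative q) * h1

theorem ddxFun_div (p q : Polynomial ℂ) (hq : q ≠ 0) :
    ddxFun (algebraMap (Polynomial ℂ) K p / algebraMap (Polynomial ℂ) K q) =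
      algebraMap (Polynomial ℂ) K
        (Polynomial.derivative p * q - p * Polynomial.derivative q) /
        algebraMap (Polynomial ℂ) K q ^ 2 := by
  generalize ha : algebraMap (Polynomial ℂ) K p / algebraMap (Polynomial ℂ) K q = a
  have hqK : algebraMap (Polynomial ℂ) K q ≠ 0 := RatFunc.algebraMap_ne_zero hq
  have hdK : algebraMap (Polynomial ℂ) K a.denom ≠ 0 :=
    RatFunc.algebraMap_ne_zero (RatFunc.denom_ne_zero a)
  have h1 : a.num * q = p * a.denom := by
    apply RatFunc.algebraMap_injective ℂ
    rw [map_mul, map_mul, ← div_eq_div_iff hdK hqK, RatFunc.num_div_denom, ha]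
  rw [ddxFun, div_eq_div_iff (pow_ne_zero 2 hdK) (pow_ne_zero 2 hqK), ← map_pow, ← map_pow,
    ← map_mul, ← map_mul, quotient_rule_aux _ _ _ _ h1]

/-- The derivation `d/dx` of the function field `ℂ(x)`. -/
def ddx : Derivation ℂ K K :=
  Derivation.mk'
    { toFun := ddxFun
      map_add' := by
        intro a b
        induction a using RatFunc.induction_on with
        | f p q hq =>
          induction b using RatFunc.induction_on with
          | f p' q' hq' =>
            have h := RatFunc.algebraMap_ne_zero hq
            have h' := RatFunc.algebraMap_ne_zero hq'
            rw [div_add_div _ _ h h', ← map_mul, ← map_mul, ← map_mul, ← map_add,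
              ddxFun_div _ _ (mul_ne_zero hq hq'), ddxFun_div _ _ hq, ddxFun_div _ _ hq']
            simp only [Polynomial.derivative_mul, map_sub, map_add, map_mul]
            field_simp
            ring
      map_smul' := by
        intro c a
        induction a using RatFunc.induction_on with
        | f p q hq =>
          have h := RatFunc.algebraMap_ne_zero hq
          have e : c • (algebraMap (Polynomial ℂ) K p / algebraMap (Polynomial ℂ) K q) =
              algebraMap (Polynomial ℂ) K (c • p) / algebraMap (Polynomial ℂ) K q := by
            rw [Algebra.smul_def, Polynomial.smul_eq_C_mul, map_mul, mul_div_assoc]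
            rfl
          rw [e, ddxFun_div _ _ hq, ddxFun_div _ _ hq, RingHom.id_apply,
            Polynomial.smul_eq_C_mul, Algebra.smul_def, ← mul_div_assoc]
          congr 1
          have e2 : algebraMap ℂ K c = algebraMap (Polynomial ℂ) K (Polynomial.C c) := rfl
          rw [e2, ← map_mul]
          congr 1
          simp only [Polynomial.derivative_mul, Polynomial.derivative_C]
          ring }
    (by
      intro a b
      change ddxFun (a * b) = a • ddxFun b + b • ddxFun a
      simp only [smul_eq_mul]
      induction a using RatFunc.induction_on with
      | f p q hq =>
        induction b using RatFunc.induction_on with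
        | f p' q' hq' =>
          have h := RatFunc.algebraMap_ne_zero hq
          have h' := RatFunc.algebraMap_ne_zero hq'
          rw [div_mul_div_comm, ← map_mul, ← map_mul,
            ddxFun_div _ _ (mul_ne_zero hq hq'), ddxFun_div _ _ hq, ddxFun_div _ _ hq']
          simp only [Polynomial.derivative_mul, map_sub, map_add, map_mul]
          field_simp
          ring)

instance : IsNoetherianRing O₀ :=
  haveI : Algebra.FiniteType ℂ O₀ :=
    Subalgebra.fg_iff_finiteType _ |>.1 ⟨{x}, by simp⟩
  Algebra.FiniteType.isNoetherianRing ℂ O₀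

instance : IsNoetherianRing Oinf :=
  haveI : Algebra.FiniteType ℂ Oinf :=
    Subalgebra.fg_iff_finiteType _ |>.1 ⟨{x⁻¹}, by simp⟩
  Algebra.FiniteType.isNoetherianRing ℂ Oinf

theorem pow_smul_mem_add {U : Type*} [AddCommGroup U] [Module K U] {z : K}
    (G : Submodule (Algebra.adjoin ℂ {z}) U) (u : U) (n m : ℕ) (h : (z ^ n : K) • u ∈ G) :
    (z ^ (n + m) : K) • u ∈ G := by
  have := G.smul_mem ((⟨z, Algebra.subset_adjoin rfl⟩ : Algebra.adjoin ℂ {z}) ^ m) h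
  rw [Subalgebra.smul_def] at this
  simpa [smul_smul, pow_add, mul_comm] using this

theorem exists_pow_mul_mem {z : K} (hz : z ≠ 0) (a : K) (ha : a ∈ Algebra.adjoin ℂ {z⁻¹}) :
    ∃ n : ℕ, z ^ n * a ∈ Algebra.adjoin ℂ {z} := by
  have hz' : z ∈ Algebra.adjoin ℂ {z} := Algebra.subset_adjoin rfl
  induction ha using Algebra.adjoin_induction with
  | mem b hb =>
    refine ⟨1, ?_⟩
    rw [Set.mem_singleton_iff.1 hb, pow_one, mul_inv_cancel₀ hz]
    exact one_mem _
  | algebraMap c => 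
    refine ⟨0, ?_⟩
    rw [pow_zero, one_mul]
    exact Subalgebra.algebraMap_mem (Algebra.adjoin ℂ {z}) c
  | add b c _ _ hb hc =>
    obtain ⟨n, hn⟩ := hb
    obtain ⟨m, hm⟩ := hc
    refine ⟨n + m, ?_⟩
    have : z ^ (n + m) * (b + c) = z ^ m * (z ^ n * b) + z ^ n * (z ^ m * c) := by ring
    rw [this]
    exact add_mem (mul_mem (pow_mem hz' m) hn) (mul_mem (pow_mem hz' n) hm)
  | mul b c _ _ hb hc =>
    obtain ⟨n, hn⟩ := hb
    obtain ⟨m, hm⟩ := hc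
    refine ⟨n + m, ?_⟩
    have : z ^ (n + m) * (b * c) = (z ^ n * b) * (z ^ m * c) := by ring
    rw [this]
    exact mul_mem hn hm

theorem polynomial_mem_O₀ (q : Polynomial ℂ) : algebraMap (Polynomial ℂ) K q ∈ O₀ := by
  induction q using Polynomial.induction_on' with
  | add p q hp hq => rw [map_add]; exact add_mem hp hq
  | monomial n c =>
    rw [← Polynomial.C_mul_X_pow_eq_monomial, map_mul, map_pow, RatFunc.algebraMap_X]
    have hc : algebraMap (Polynomial ℂ) K (Polynomial.C c) ∈ O₀ := by
      have e : algebraMap ℂ K c = algebraMap (Polynomial ℂ) K (Polynomial.C c) := rfl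
      rw [← e]
      exact O₀.algebraMap_mem c
    have hx : x ∈ O₀ := Algebra.subset_adjoin rfl
    exact mul_mem hc (pow_mem hx n)

/-! ### Vector bundles on the projective line -/

section Bundles

variable {V : Type*} [AddCommGroup V] [Module K V] [Module ℂ V] [IsScalarTower ℂ K V]
variable {W : Type*} [AddCommGroup W] [Module K W] [Module ℂ W] [IsScalarTower ℂ K W]

/-- An (algebraic) vector bundle on the projective line with generic fibre `V`: a module of
sections `M₀` over the chart `x ≠ ∞` and a module of sections `Minf` over the chart `x ≠ 0`,
finitely generated and (being inside `V`) torsion free, hence locally free, which agree over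
`x ≠ 0, ∞`, that is `M₀[x⁻¹] = Minf[x]`, and generate `V`. -/
structure Bundle (V : Type*) [AddCommGroup V] [Module K V] where
  M₀ : Submodule O₀ V
  Minf : Submodule Oinf V
  fg₀ : M₀.FG
  fgInf : Minf.FG
  glue₀ : ∀ v ∈ M₀, ∃ n : ℕ, (x⁻¹ ^ n : K) • v ∈ Minf
  glueInf : ∀ v ∈ Minf, ∃ n : ℕ, (x ^ n : K) • v ∈ M₀
  generate : ∀ v : V, ∃ a : O₀, a ≠ 0 ∧ a • v ∈ M₀

namespace Bundle

/-- The sections over `x ≠ ∞`, as a complex vector space. -/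
def sec₀ (E : Bundle V) : Submodule ℂ V := E.M₀.restrictScalars ℂ

theorem smul_mem₀ {V : Type*} [AddCommGroup V] [Module K V] (E : Bundle V) {a : K} (ha : a ∈ O₀)
    {v : V} (hv : v ∈ E.M₀) : a • v ∈ E.M₀ :=
  E.M₀.smul_mem ⟨a, ha⟩ hv

/-- Multiplication by `x - c` on the sections over `x ≠ ∞`. -/
def mulXSub (E : Bundle V) (c : ℂ) : E.sec₀ →ₗ[ℂ] E.sec₀ where
  toFun m := ⟨xSub c • (m : V), E.smul_mem₀ (xSub_mem c) m.2⟩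
  map_add' _ _ := Subtype.ext (smul_add _ _ _)
  map_smul' _ _ := Subtype.ext (smul_comm _ _ _)

/-- The sections over `x ≠ ∞` that vanish at the point `c`. -/
def vanishing (E : Bundle V) (c : ℂ) : Submodule ℂ E.sec₀ := LinearMap.range (E.mulXSub c)

/-- The fibre `E_c = M₀ / (x - c) M₀` of `E` at the point `c ≠ ∞`. -/
abbrev Fibre (E : Bundle V) (c : ℂ) : Type _ := E.sec₀ ⧸ E.vanishing c

/-- The value at `c` of a section over `x ≠ ∞`. -/
def value (E : Bundle V) (c : ℂ) : E.sec₀ →ₗ[ℂ] E.Fibre c := (E.vanishing c).mkQ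

/-- `E` has degree `d`: for suitable frames of `E` over the two charts, the transition function
of the determinant line bundle is that of `𝒪(d)`, namely `x ^ d` up to a nonzero constant. -/
def HasDegree (E : Bundle V) (d : ℤ) : Prop :=
  ∃ b₀ bInf : Module.Basis (Fin (Module.finrank K V)) K V,
    Submodule.span O₀ (Set.range b₀) = E.M₀ ∧
    Submodule.span Oinf (Set.range bInf) = E.Minf ∧
    ∃ c : ℂ, c ≠ 0 ∧ b₀.det bInf = algebraMap ℂ K c * x ^ d

/-- Morphisms of vector bundles. -/
structure Hom (E : Bundle V) (F : Bundle W) where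
  toLin : V →ₗ[K] W
  map₀ : ∀ v ∈ E.M₀, toLin v ∈ F.M₀
  mapInf : ∀ v ∈ E.Minf, toLin v ∈ F.Minf

/-- The map on sections over `x ≠ ∞` given by a morphism. -/
def Hom.sections {E : Bundle V} {F : Bundle W} (φ : E.Hom F) : E.sec₀ →ₗ[ℂ] F.sec₀ :=
  (φ.toLin.restrictScalars ℂ).restrict φ.map₀

/-- The linear map on fibres given by a morphism. -/
def Hom.fibre {E : Bundle V} {F : Bundle W} (φ : E.Hom F) (c : ℂ) :
    E.Fibre c →ₗ[ℂ] F.Fibre c :=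
  (E.vanishing c).mapQ (F.vanishing c) φ.sections (by
    rintro _ ⟨m, rfl⟩
    exact ⟨φ.sections m, Subtype.ext (map_smul φ.toLin (xSub c) (m : V)).symm⟩)

/-- Isomorphisms of vector bundles. -/
structure Iso (E : Bundle V) (F : Bundle W) where
  toEquiv : V ≃ₗ[K] W
  mem₀ : ∀ v, toEquiv v ∈ F.M₀ ↔ v ∈ E.M₀
  memInf : ∀ v, toEquiv v ∈ F.Minf ↔ v ∈ E.Minf

/-- An isomorphism as a morphism. -/
def Iso.hom {E : Bundle V} {F : Bundle W} (ψ : E.Iso F) : E.Hom F where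
  toLin := ψ.toEquiv
  map₀ v hv := (ψ.mem₀ v).2 hv
  mapInf v hv := (ψ.memInf v).2 hv

/-- The subbundle of `E` with generic fibre `S`; its sections are the sections of `E` that lie
in `S`. Every subbundle (with locally free quotient) is of this form, for a unique `S`. -/
def sub (E : Bundle V) (S : Submodule K V) : Bundle S where
  M₀ := E.M₀.comap (S.subtype.restrictScalars O₀)
  Minf := E.Minf.comap (S.subtype.restrictScalars Oinf)
  fg₀ := by
    have : IsNoetherian O₀ E.M₀ := isNoetherian_of_fg_of_noetherian _ E.fg₀
    refine Submodule.fg_of_fg_map_injective (S.subtype.restrictScalars O₀)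
      Subtype.val_injective ?_
    exact Submodule.FG.of_le E.fg₀ (Submodule.map_comap_le _ _)
  fgInf := by
    have : IsNoetherian Oinf E.Minf := isNoetherian_of_fg_of_noetherian _ E.fgInf
    refine Submodule.fg_of_fg_map_injective (S.subtype.restrictScalars Oinf)
      Subtype.val_injective ?_
    exact Submodule.FG.of_le E.fgInf (Submodule.map_comap_le _ _)
  glue₀ v hv := E.glue₀ v hv
  glueInf v hv := E.glueInf v hv
  generate v := E.generate v

/-- The inclusion of a subbundle. -/
def incl (E : Bundle V) (S : Submodule K V) : (E.sub S).Hom E where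
  toLin := S.subtype
  map₀ _ hv := hv
  mapInf _ hv := hv

/-- The fibre at `c` of the subbundle of `E` with generic fibre `S`, as a subspace of `E_c`. -/
def subFibre (E : Bundle V) (S : Submodule K V) (c : ℂ) : Submodule ℂ (E.Fibre c) :=
  LinearMap.range ((E.incl S).fibre c)

/-- The direct sum of two vector bundles. -/
def prod (E : Bundle V) (F : Bundle W) : Bundle (V × W) where
  M₀ := E.M₀.prod F.M₀
  Minf := E.Minf.prod F.Minf
  fg₀ := E.fg₀.prod F.fg₀
  fgInf := E.fgInf.prod F.fgInf
  glue₀ := by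
    rintro ⟨v, w⟩ ⟨hv, hw⟩
    obtain ⟨n, hn⟩ := E.glue₀ v hv
    obtain ⟨m, hm⟩ := F.glue₀ w hw
    exact ⟨n + m, pow_smul_mem_add _ _ n m hn, by rw [add_comm]; exact pow_smul_mem_add _ _ m n hm⟩
  glueInf := by
    rintro ⟨v, w⟩ ⟨hv, hw⟩
    obtain ⟨n, hn⟩ := E.glueInf v hv
    obtain ⟨m, hm⟩ := F.glueInf w hw
    exact ⟨n + m, pow_smul_mem_add _ _ n m hn, by rw [add_comm]; exact pow_smul_mem_add _ _ m n hm⟩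
  generate := by
    rintro ⟨v, w⟩
    obtain ⟨a, ha, hv⟩ := E.generate v
    obtain ⟨b, hb, hw⟩ := F.generate w
    refine ⟨a * b, mul_ne_zero ha hb, ?_, ?_⟩
    · have := E.M₀.smul_mem b hv
      rwa [smul_smul, mul_comm] at this
    · have := F.M₀.smul_mem a hw
      rwa [smul_smul] at this

end Bundle

/-- The line bundle `𝒪(d)`: generated by `1` over `x ≠ ∞` and by `x ^ d` over `x ≠ 0`. The
section `1` over `x ≠ ∞` extends, for `d ≥ 0`, to a global section vanishing to order `d` at
`∞`. -/
def lineBundle (d : ℤ) : Bundle K where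
  M₀ := Submodule.span O₀ {1}
  Minf := Submodule.span Oinf {x ^ d}
  fg₀ := Submodule.fg_span_singleton _
  fgInf := Submodule.fg_span_singleton _
  glue₀ v hv := by
    obtain ⟨a, rfl⟩ := Submodule.mem_span_singleton.1 hv
    obtain ⟨n, hn⟩ := exists_pow_mul_mem (z := x⁻¹) (inv_ne_zero RatFunc.X_ne_zero) (a : K)
      (by rw [inv_inv]; exact a.2)
    refine ⟨n + d.natAbs, Submodule.mem_span_singleton.2
      ⟨⟨x⁻¹ ^ n * a, hn⟩ * ⟨x⁻¹, Algebra.subset_adjoin rfl⟩ ^ (d.natAbs + d).toNat, ?_⟩⟩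
    have h0 : x ≠ 0 := RatFunc.X_ne_zero
    have h1 : (((d.natAbs + d).toNat : ℕ) : ℤ) = d.natAbs + d := Int.toNat_of_nonneg (by omega)
    have h2 : (x⁻¹ : K) ^ (d.natAbs + d).toNat * x ^ d = x⁻¹ ^ d.natAbs := by
      rw [← zpow_natCast (x⁻¹ : K) (d.natAbs + d).toNat, h1, inv_zpow', ← zpow_add₀ h0,
        ← zpow_natCast (x⁻¹ : K), inv_zpow']
      congr 1
      omega
    simp only [Subalgebra.smul_def, smul_eq_mul, MulMemClass.coe_mul, SubmonoidClass.coe_pow,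
      mul_one]
    rw [mul_assoc, h2]
    ring
  glueInf v hv := by
    obtain ⟨a, rfl⟩ := Submodule.mem_span_singleton.1 hv
    obtain ⟨n, hn⟩ := exists_pow_mul_mem (z := x) RatFunc.X_ne_zero (a : K) a.2
    refine ⟨n + d.natAbs, Submodule.mem_span_singleton.2
      ⟨⟨x ^ n * a, hn⟩ * ⟨x, Algebra.subset_adjoin rfl⟩ ^ (d.natAbs + d).toNat, ?_⟩⟩
    have h0 : x ≠ 0 := RatFunc.X_ne_zero
    have h1 : (((d.natAbs + d).toNat : ℕ) : ℤ) = d.natAbs + d := Int.toNat_of_nonneg (by omega)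
    have h2 : (x : K) ^ (d.natAbs + d).toNat = x ^ d.natAbs * x ^ d := by
      rw [← zpow_natCast (x : K) (d.natAbs + d).toNat, h1, zpow_add₀ h0, zpow_natCast]
    simp only [Subalgebra.smul_def, smul_eq_mul, MulMemClass.coe_mul, SubmonoidClass.coe_pow,
      mul_one]
    rw [h2]
    ring
  generate v := by
    induction v using RatFunc.induction_on with
    | f p q hq =>
      have h := RatFunc.algebraMap_ne_zero hq
      refine ⟨⟨algebraMap (Polynomial ℂ) K q, polynomial_mem_O₀ q⟩, fun e => h ?_,
        Submodule.mem_span_singleton.2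
          ⟨⟨algebraMap (Polynomial ℂ) K p, polynomial_mem_O₀ p⟩, ?_⟩⟩
      · exact congrArg Subtype.val e
      · simp only [Subalgebra.smul_def, smul_eq_mul, mul_one]
        rw [mul_div_cancel₀ _ h]

/-! ### Logarithmic connections -/

/-- A logarithmic connection `∇ : E → E ⊗ Ω¹(log D)`, `D = t₁ + ⋯ + tₙ` (distinct points
`≠ ∞`). Over the function field `∇ v = nabla v ⊗ dx`. The sheaf `Ω¹(log D)` is generated by
`dx / ∏ (x - tᵢ)` over `x ≠ ∞`, and by `dy / ∏ (1 - tᵢ y)` over `x ≠ 0`, where `y = x⁻¹`, so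
`dx = - x² dy`. -/
structure LogConnection {n : ℕ} (t : Fin n → ℂ) (E : Bundle V) where
  nabla : V →ₗ[ℂ] V
  leibniz : ∀ (a : K) (v : V), nabla (a • v) = a • nabla v + ddx a • v
  log₀ : ∀ v ∈ E.M₀, (∏ i, xSub (t i)) • nabla v ∈ E.M₀
  logInf : ∀ v ∈ E.Minf,
    (∏ i, (1 - algebraMap ℂ K (t i) * x⁻¹)) • (-x ^ 2 : K) • nabla v ∈ E.Minf

namespace LogConnection

variable {n : ℕ} {t : Fin n → ℂ} {E : Bundle V}

/-- The coefficient of `∇ m` with respect to `dx / ∏ (x - tᵢ)`. -/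
def coeff (D : LogConnection t E) : E.sec₀ →ₗ[ℂ] E.sec₀ where
  toFun m := ⟨(∏ i, xSub (t i)) • D.nabla (m : V), D.log₀ m m.2⟩
  map_add' m m' := Subtype.ext (by
    change _ • D.nabla ((m : V) + (m' : V)) = _ • D.nabla (m : V) + _ • D.nabla (m' : V)
    rw [map_add, smul_add])
  map_smul' c m := Subtype.ext (by
    change _ • D.nabla (c • (m : V)) = c • _ • D.nabla (m : V)
    rw [map_smul, smul_comm])

theorem coeff_vanishing (D : LogConnection t E) (i : Fin n) :
    E.vanishing (t i) ≤ (E.vanishing (t i)).comap D.coeff := by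
  rintro _ ⟨m, rfl⟩
  have hd : ddx (xSub (t i)) = 1 := by
    rw [xSub, map_sub, Derivation.map_algebraMap, sub_zero]
    have h := ddxFun_div Polynomial.X 1 one_ne_zero
    simp only [map_one, div_one, RatFunc.algebraMap_X, Polynomial.derivative_X, mul_one,
      Polynomial.derivative_one, mul_zero, sub_zero, one_pow] at h
    exact h
  have hp : ∏ j ∈ Finset.univ.erase i, xSub (t j) ∈ O₀ := prod_mem fun j _ => xSub_mem (t j)
  refine ⟨D.coeff m + ⟨(∏ j ∈ Finset.univ.erase i, xSub (t j)) • (m : V),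
    E.smul_mem₀ hp m.2⟩, Subtype.ext ?_⟩
  change xSub (t i) • ((∏ i, xSub (t i)) • D.nabla (m : V) +
      (∏ j ∈ Finset.univ.erase i, xSub (t j)) • (m : V)) =
    (∏ i, xSub (t i)) • D.nabla (xSub (t i) • (m : V))
  rw [D.leibniz, hd, one_smul, smul_add, smul_add, smul_comm, smul_smul (xSub (t i)),
    Finset.mul_prod_erase Finset.univ (fun j => xSub (t j)) (Finset.mem_univ i)]

/-- The residue of `∇` at `tᵢ`, an endomorphism of the fibre at `tᵢ`: if
`∇ m = s ⊗ dx / ∏ⱼ (x - tⱼ)` then the residue maps `m(tᵢ)` to `s(tᵢ) / ∏_{j ≠ i} (tᵢ - tⱼ)`. -/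
def residue (D : LogConnection t E) (i : Fin n) :
    E.Fibre (t i) →ₗ[ℂ] E.Fibre (t i) :=
  (∏ j ∈ Finset.univ.erase i, (t i - t j))⁻¹ •
    (E.vanishing (t i)).mapQ (E.vanishing (t i)) D.coeff (D.coeff_vanishing i)

end LogConnection

/-! ### Quasi-parabolic bundles -/

/-- A quasi-parabolic structure on `E` at the points `tᵢ`: a line in each fibre `E_{tᵢ}`. -/
structure QuasiParabolic {n : ℕ} (t : Fin n → ℂ) (E : Bundle V) where
  line : ∀ i, Submodule ℂ (E.Fibre (t i))
  finrank_line : ∀ i, Module.finrank ℂ (line i) = 1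

namespace QuasiParabolic

variable {n : ℕ} {t : Fin n → ℂ} {E : Bundle V}

/-- The connection is compatible with the quasi-parabolic structure, with residue `rm i` on `Pᵢ`
and `rp i` on `E_{tᵢ} / Pᵢ`. -/
def HasResidues (P : QuasiParabolic t E) (D : LogConnection t E) (rp rm : Fin n → ℂ) : Prop :=
  ∀ i, (∀ v ∈ P.line i, D.residue i v ∈ P.line i) ∧
    (∀ v ∈ P.line i, D.residue i v = rm i • v) ∧
    (∀ v, (P.line i).mkQ (D.residue i v) = rp i • (P.line i).mkQ v)

/-- `(E, P)` is the direct sum of its subbundles with generic fibres `S₁`, `S₂` and of the induced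
quasi-parabolic structures. -/
def IsDecomposition (P : QuasiParabolic t E) (S₁ S₂ : Submodule K V) : Prop :=
  IsCompl S₁ S₂ ∧
  (∀ v ∈ E.M₀, ∃ v₁ ∈ S₁, ∃ v₂ ∈ S₂, v₁ ∈ E.M₀ ∧ v₂ ∈ E.M₀ ∧ v = v₁ + v₂) ∧
  (∀ v ∈ E.Minf, ∃ v₁ ∈ S₁, ∃ v₂ ∈ S₂, v₁ ∈ E.Minf ∧ v₂ ∈ E.Minf ∧ v = v₁ + v₂) ∧
  ∀ i, P.line i =
    (P.line i ⊓ E.subFibre S₁ (t i)) ⊔ (P.line i ⊓ E.subFibre S₂ (t i))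

/-- `(E, P)` is nonzero and is not the direct sum of two nonzero quasi-parabolic bundles. -/
def Indecomposable (P : QuasiParabolic t E) : Prop :=
  Nontrivial V ∧ ∀ S₁ S₂ : Submodule K V, P.IsDecomposition S₁ S₂ → S₁ = ⊥ ∨ S₂ = ⊥

/-- `(E, P)` has no endomorphisms preserving the `Pᵢ` other than the scalars `c ∈ ℂ`. -/
def Simple (P : QuasiParabolic t E) : Prop :=
  ∀ φ : E.Hom E, (∀ i, ∀ v ∈ P.line i, φ.fibre (t i) v ∈ P.line i) →
    ∃ c : ℂ, ∀ v, φ.toLin v = c • v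

end QuasiParabolic

end Bundles

/-! ### The bundle `B = 𝒪 ⊕ 𝒪(1)` and its quasi-parabolic structures -/

/-- The bundle `B = 𝒪 ⊕ 𝒪(1)`. -/
def B : Bundle (K × K) := (lineBundle 0).prod (lineBundle 1)

/-- The unit section `e` of `𝒪 ⊂ B`. -/
def secE : B.sec₀ := ⟨(1, 0), Submodule.mem_span_singleton_self _, zero_mem _⟩

/-- The section `f` of `𝒪(1) ⊂ B` vanishing (only) at `∞`. -/
def secF : B.sec₀ := ⟨(0, 1), zero_mem _, Submodule.mem_span_singleton_self _⟩

/-- The section `x f` of `𝒪(1) ⊂ B`. -/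
def secXF : B.sec₀ := ⟨(0, x), zero_mem _, Submodule.mem_span_singleton.2
  ⟨⟨x, Algebra.subset_adjoin rfl⟩, mul_one x⟩⟩

/-- The line in `B_c` with coordinate `u`: spanned by `e(c) + u f(c)` if `u` is finite, by `f(c)`
if `u = ∞`. -/
def coordLine (c : ℂ) (u : OnePoint ℂ) : Submodule ℂ (B.Fibre c) :=
  u.elim (ℂ ∙ B.value c secF) fun a => ℂ ∙ (B.value c secE + a • B.value c secF)

/-- The space `H⁰(B) = ℂ ⊕ H⁰(𝒪(1))` of global sections of `B`; `(p, a, b)` stands for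
`p e + (a + b x) f`. The projective line is the space of lines `ℓ_c ⊂ H⁰(𝒪(1))` (the sections
vanishing at `c`), and `B_c = ℂ ⊕ H⁰(𝒪(1)) / ℓ_c`. -/
abbrev GlobalB : Type := ℂ × ℂ × ℂ

/-- The global section `p e + (a + b x) f`, restricted to `x ≠ ∞`. -/
def globalSection : GlobalB →ₗ[ℂ] B.sec₀ where
  toFun s := s.1 • secE + s.2.1 • secF + s.2.2 • secXF
  map_add' s s' := by
    simp only [Prod.fst_add, Prod.snd_add, add_smul]
    abel
  map_smul' a s := by
    simp only [Prod.smul_fst, Prod.smul_snd, smul_add, smul_smul, smul_eq_mul, RingHom.id_apply]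

/-- The value at `c` of a global section of `B`. -/
def evalB (c : ℂ) : GlobalB →ₗ[ℂ] B.Fibre c := B.value c ∘ₗ globalSection

/-- The projective plane `ℙ(ℂ ⊕ H⁰(𝒪(1))*)` of lines in the dual of `H⁰(B)`. -/
abbrev Plane : Type := ℙ ℂ (Module.Dual ℂ GlobalB)

/-- The origin of the plane, the line `ℂ ⊂ ℂ ⊕ H⁰(𝒪(1))*`. -/
def origin : Plane :=
  Projectivization.mk ℂ (LinearMap.fst ℂ ℂ (ℂ × ℂ))
    (fun h => one_ne_zero (α := ℂ) (LinearMap.congr_fun h (1, 0)))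

/-- The point `U` of the plane corresponds to the line `L ⊂ B_c`: it is the orthogonal of the
plane `L̃ ⊂ H⁰(B)` of all global sections whose value at `c` lies in `L`. -/
def IsPointOf (c : ℂ) (L : Submodule ℂ (B.Fibre c)) (U : Plane) : Prop :=
  U.submodule = (L.comap (evalB c)).dualAnnihilator

section Position

variable {V : Type*} [AddCommGroup V] [Module K V] [Module ℂ V] [IsScalarTower ℂ K V]
variable {n : ℕ} {t : Fin n → ℂ} {E : Bundle V}

/-- `E ≅ B`, at most one coordinate `uᵢ` of the resulting quasi-parabolic structure on `B` is `∞`,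
and the lines with `uᵢ ≠ ∞` are not all contained in one subbundle of `B` isomorphic to `𝒪`. -/
def CoordinateCondition (P : QuasiParabolic t E) : Prop :=
  ∃ (ψ : E.Iso B) (u : Fin n → OnePoint ℂ),
    (∀ i, (P.line i).map (ψ.hom.fibre (t i)) = coordLine (t i) (u i)) ∧
    (∀ i j, u i = ∞ → u j = ∞ → i = j) ∧
    ¬ ∃ S : Submodule K (K × K), Nonempty ((B.sub S).Iso (lineBundle 0)) ∧
      ∀ i, u i ≠ ∞ → (P.line i).map (ψ.hom.fibre (t i)) ≤ B.subFibre S (t i)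

/-- `E ≅ B`, and among the points of the projective plane given by the resulting quasi-parabolic
structure on `B` there are three non-colinear ones distinct from the origin. -/
def ProjectiveCondition (P : QuasiParabolic t E) : Prop :=
  ∃ (ψ : E.Iso B) (U : Fin n → Plane),
    (∀ i, IsPointOf (t i) ((P.line i).map (ψ.hom.fibre (t i))) (U i)) ∧
    ∃ i j k, i ≠ j ∧ i ≠ k ∧ j ≠ k ∧ U i ≠ origin ∧ U j ≠ origin ∧ U k ≠ origin ∧
      ¬ Projectivization.IsCollinear {U i, U j, U k}

end Position

/-! ### Residues -/

/-- The Fuchs relation for connections of degree `d`. -/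
def FuchsRelation {n : ℕ} (d : ℤ) (rp rm : Fin n → ℂ) : Prop :=
  ∑ i, (rp i + rm i) + d = 0

/-- No sum `r₁^{σ₁} + ⋯ + rₙ^{σₙ}`, `σᵢ = ±`, is an integer. -/
def KostovGeneric {n : ℕ} (rp rm : Fin n → ℂ) : Prop :=
  ∀ σ : Fin n → Bool, ∀ m : ℤ, ∑ i, (if σ i then rp i else rm i) ≠ m

/-- No difference `rᵢ⁺ - rᵢ⁻` is an integer. -/
def Nonresonant {n : ℕ} (rp rm : Fin n → ℂ) : Prop :=
  ∀ i, ∀ m : ℤ, rp i - rm i ≠ m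

/-- Kostov-generic and nonresonant. -/
def Nonspecial {n : ℕ} (rp rm : Fin n → ℂ) : Prop :=
  KostovGeneric rp rm ∧ Nonresonant rp rm

end P1

end

set_option linter.unusedSectionVars false

noncomputable section

namespace P1

/-! ### The rings of functions on the two charts -/

/-! All conditions are compared with one numerical condition, `IsGeneral`: in some splitting `E ≅ 𝒪
⊕ 𝒪(1)`, three of the coordinates `uᵢ` are finite and no affine function takes the values `uᵢ` at
the corresponding `tᵢ`.

By the Birkhoff–Grothendieck argument (`exists_splitting`), `E ≅ 𝒪(m) ⊕ 𝒪(n)` with `m + n = 1` and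
`m < n`. If a polynomial of degree at most `n - m` takes the values `uᵢ` wherever these are finite,
the shear by it turns every line into a coordinate axis, and `(E, P)` decomposes. For `m < 0` four
values can always be interpolated; for `m = 0` the obstruction is exactly `IsGeneral`. Hence
indecomposable bundles are general (`exists_isGeneral_of_indecomposable`).

In the other direction, an endomorphism of `𝒪 ⊕ 𝒪(1)` is triangular with constants `α`, `δ` on the
diagonal and an affine entry `c + d x` below it. It preserves a line of finite coordinate `uᵢ` iff
`c + d tᵢ = (α - δ) uᵢ`, and generality leaves only scalars (`simple_of_isGeneral`). Simple implies
indecomposable because the projection onto a direct summand is an endomorphism.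

A connection on a decomposable bundle induces one on a summand `𝒪(m)`. Its residues are `rᵢ⁺` or
`rᵢ⁻` and sum to `-m` by the residue theorem (`sum_residue_fst`), which contradicts Kostov
genericity. Conversely a connection is written down as `d + ∑ Aᵢ dx / (x - tᵢ)`. Where `uᵢ` is
finite, prescribing the spectrum and the line of `Aᵢ` leaves one free entry `βᵢ`, and extension over
`∞` imposes three linear equations on `β`. Generality makes them solvable with `β` supported on
three points (`exists_hasResidues`).

Conditions 4 and 5 restate generality: the subbundles `𝒪 ⊂ B` carrying a line of finite coordinate
are graphs of affine functions, and the determinant of the three functionals defining the points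
`Uᵢ` is, up to sign, the expression in `IsGeneral`. -/

theorem x_ne_zero : x ≠ 0 := RatFunc.X_ne_zero

theorem transcendental_x : Transcendental ℂ x := RatFunc.transcendental_X

theorem transcendental_x_inv : Transcendental ℂ x⁻¹ := fun h =>
  transcendental_x (by simpa using h.inv)

/-- The ring generated by a nonconstant function is a polynomial ring. -/
def polyEquiv {z : K} (hz : Transcendental ℂ z) :
    Polynomial ℂ ≃ₐ[ℂ] Algebra.adjoin ℂ {z} :=
  (AlgEquiv.ofInjective (Polynomial.aeval z) (transcendental_iff_injective.1 hz)).trans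
    (Subalgebra.equivOfEq _ _ (Algebra.adjoin_singleton_eq_range_aeval ℂ z).symm)

theorem coe_polyEquiv {z : K} (hz : Transcendental ℂ z) (p : Polynomial ℂ) :
    (polyEquiv hz p : K) = Polynomial.aeval z p := rfl

theorem isPrincipalIdealRing_adjoin {z : K} (hz : Transcendental ℂ z) :
    IsPrincipalIdealRing (Algebra.adjoin ℂ {z}) :=
  IsPrincipalIdealRing.of_surjective (polyEquiv hz) (polyEquiv hz).surjective

theorem aeval_x (p : Polynomial ℂ) : Polynomial.aeval x p = algebraMap (Polynomial ℂ) K p := by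
  induction p using Polynomial.induction_on' with
  | add p q hp hq => rw [map_add, map_add, hp, hq]
  | monomial n c =>
    rw [Polynomial.aeval_monomial, ← Polynomial.C_mul_X_pow_eq_monomial, map_mul, map_pow,
      RatFunc.algebraMap_X]
    rfl

theorem mem_O₀_iff {a : K} : a ∈ O₀ ↔ ∃ p : Polynomial ℂ, algebraMap (Polynomial ℂ) K p = a := by
  constructor
  · intro ha
    obtain ⟨p, hp⟩ := (polyEquiv transcendental_x).surjective ⟨a, ha⟩
    refine ⟨p, ?_⟩
    rw [← aeval_x, ← coe_polyEquiv transcendental_x, hp]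
  · rintro ⟨p, rfl⟩
    exact polynomial_mem_O₀ p

theorem x_mem : x ∈ O₀ := Algebra.subset_adjoin rfl

theorem x_inv_mem : x⁻¹ ∈ Oinf := Algebra.subset_adjoin rfl

/-- The coordinate as a function on `x ≠ ∞`. -/
def X₀ : O₀ := ⟨x, x_mem⟩

/-- The value at `c` of functions on `x ≠ ∞`. -/
def ev (c : ℂ) : O₀ →ₐ[ℂ] ℂ :=
  (Polynomial.aeval c).comp (polyEquiv transcendental_x).symm.toAlgHom

theorem ev_polynomial (c : ℂ) (p : Polynomial ℂ) (h : algebraMap (Polynomial ℂ) K p ∈ O₀) :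
    ev c ⟨algebraMap (Polynomial ℂ) K p, h⟩ = p.eval c := by
  have : (⟨algebraMap (Polynomial ℂ) K p, h⟩ : O₀) = polyEquiv transcendental_x p :=
    Subtype.ext (by rw [coe_polyEquiv, aeval_x])
  rw [this]
  simp [ev]

@[simp]
theorem ev_X₀ (c : ℂ) : ev c X₀ = c := by
  have := ev_polynomial c Polynomial.X (by rw [RatFunc.algebraMap_X]; exact x_mem)
  rw [Polynomial.eval_X] at this
  refine Eq.trans ?_ this
  congr 1

/-- The factor theorem. It identifies the kernel of evaluation at `c` with the multiples of `x - c`,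
which are divided out in the fibre at `c`. -/
theorem exists_eq_of_ev_eq_zero {c : ℂ} {g : O₀} (h : ev c g = 0) :
    ∃ g' ∈ O₀, (g : K) = xSub c * g' := by
  obtain ⟨a, ha⟩ := g
  obtain ⟨p, rfl⟩ := mem_O₀_iff.1 ha
  rw [ev_polynomial] at h
  obtain ⟨q, rfl⟩ := Polynomial.dvd_iff_isRoot.2 h
  refine ⟨_, polynomial_mem_O₀ q, ?_⟩
  simp only [map_mul, map_sub, RatFunc.algebraMap_X]
  rfl

/-- The degree is minus the order of vanishing at `∞`, so a function regular there cannot have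
positive degree. -/
theorem intDegree_nonpos {a : K} (ha : a ∈ Oinf) : a.intDegree ≤ 0 := by
  induction ha using Algebra.adjoin_induction with
  | mem b hb =>
    rw [Set.mem_singleton_iff.1 hb, RatFunc.intDegree_inv, RatFunc.intDegree_X]
    norm_num
  | algebraMap c => exact (RatFunc.intDegree_C c).le
  | add b c _ _ hb hc =>
    by_cases h : c = 0
    · simpa [h] using hb
    by_cases h' : b + c = 0
    · simp [h']
    exact (RatFunc.intDegree_add_le h h').trans (max_le hb hc)
  | mul b c _ _ hb hc =>
    by_cases h : b = 0
    · simp [h]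
    by_cases h' : c = 0
    · simp [h']
    rw [RatFunc.intDegree_mul h h']
    omega

theorem intDegree_zpow_x (d : ℤ) : (x ^ d).intDegree = d := by
  have h (n : ℕ) : (x ^ n).intDegree = n := by
    induction n with
    | zero => simp
    | succ n ih =>
      rw [pow_succ, RatFunc.intDegree_mul (pow_ne_zero _ x_ne_zero) x_ne_zero, ih,
        RatFunc.intDegree_X]
      simp
  obtain ⟨n, rfl | rfl⟩ := d.eq_nat_or_neg
  · rw [zpow_natCast, h]
  · rw [zpow_neg, zpow_natCast, RatFunc.intDegree_inv, h]

/-- Together with `mem_Oinf_of_natDegree_le` this describes the global sections of `𝒪(d)` as the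
polynomials of degree at most `d`. -/
theorem natDegree_le_of_mem {d : ℤ} {p : Polynomial ℂ} (hp : p ≠ 0)
    (h : x ^ (-d) * algebraMap (Polynomial ℂ) K p ∈ Oinf) : (p.natDegree : ℤ) ≤ d := by
  have := intDegree_nonpos h
  rw [RatFunc.intDegree_mul (zpow_ne_zero _ x_ne_zero) (RatFunc.algebraMap_ne_zero hp),
    intDegree_zpow_x, RatFunc.intDegree_polynomial] at this
  omega

theorem zpow_mem_Oinf {d : ℤ} : x ^ d ∈ Oinf ↔ d ≤ 0 := by
  constructor
  · intro h
    simpa [intDegree_zpow_x] using intDegree_nonpos h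
  · intro h
    obtain ⟨n, rfl⟩ := Int.exists_eq_neg_ofNat h
    rw [zpow_neg, zpow_natCast, ← inv_pow]
    exact pow_mem x_inv_mem n

theorem mem_Oinf_of_natDegree_le {d : ℤ} {p : Polynomial ℂ} (h : (p.natDegree : ℤ) ≤ d) :
    x ^ (-d) * algebraMap (Polynomial ℂ) K p ∈ Oinf := by
  rw [← aeval_x, Polynomial.aeval_eq_sum_range, Finset.mul_sum]
  refine sum_mem fun i hi => ?_
  rw [mul_smul_comm, ← zpow_natCast, ← zpow_add₀ x_ne_zero]
  refine Subalgebra.smul_mem _ (zpow_mem_Oinf.2 ?_) _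
  have := Finset.mem_range.1 hi
  omega

theorem algebraMap_mem_O₀ (c : ℂ) : algebraMap ℂ K c ∈ O₀ := O₀.algebraMap_mem c

/-- Global sections of `𝒪`; the next two lemmas treat `𝒪(1)` and `𝒪(-1)`. These are the possible
matrix entries of an endomorphism of `𝒪 ⊕ 𝒪(1)`. -/
theorem eq_const_of_mem {a : K} (h₀ : a ∈ O₀) (hinf : a ∈ Oinf) :
    ∃ c : ℂ, a = algebraMap ℂ K c := by
  obtain ⟨p, rfl⟩ := mem_O₀_iff.1 h₀
  by_cases hp : p = 0
  · exact ⟨0, by simp [hp]⟩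
  have := natDegree_le_of_mem (d := 0) hp (by simpa using hinf)
  rw [Polynomial.eq_C_of_natDegree_le_zero (p := p) (by omega)]
  exact ⟨_, rfl⟩

theorem eq_affine_of_mem {a : K} (h₀ : a ∈ O₀) (hinf : x⁻¹ * a ∈ Oinf) :
    ∃ c d : ℂ, a = algebraMap ℂ K c + algebraMap ℂ K d * x := by
  obtain ⟨p, rfl⟩ := mem_O₀_iff.1 h₀
  by_cases hp : p = 0
  · exact ⟨0, 0, by simp [hp]⟩
  have := natDegree_le_of_mem (d := 1) hp (by simpa using hinf)
  obtain ⟨a, b, rfl⟩ := Polynomial.exists_eq_X_add_C_of_natDegree_le_one (p := p) (by omega)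
  exact ⟨b, a, by rw [map_add, map_mul, RatFunc.algebraMap_X, add_comm]; rfl⟩

theorem eq_zero_of_mem {a : K} (h₀ : a ∈ O₀) (hinf : x * a ∈ Oinf) : a = 0 := by
  obtain ⟨p, rfl⟩ := mem_O₀_iff.1 h₀
  by_cases hp : p = 0
  · simp [hp]
  have := natDegree_le_of_mem (d := -1) hp (by simpa using hinf)
  omega

/-- A function on `x ≠ 0` is the sum of its value at `∞` and of a function vanishing at `∞`. -/
theorem exists_value_inf {a : K} (ha : a ∈ Oinf) :
    ∃ c : ℂ, ∃ b ∈ Oinf, a = algebraMap ℂ K c + x⁻¹ * b := by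
  obtain ⟨p, hp⟩ := (polyEquiv transcendental_x_inv).surjective ⟨a, ha⟩
  have hp' : Polynomial.aeval x⁻¹ p = a := by
    rw [← coe_polyEquiv transcendental_x_inv, hp]
  refine ⟨p.coeff 0, Polynomial.aeval x⁻¹ p.divX, (polyEquiv transcendental_x_inv p.divX).2, ?_⟩
  conv_lhs => rw [← hp', ← Polynomial.divX_mul_X_add p]
  simp only [map_add, map_mul, Polynomial.aeval_X, Polynomial.aeval_C]
  ring

/-- A function divisible by `x⁻¹` vanishes at `∞`; otherwise `x` itself would be regular there. -/
theorem const_eq_zero_of_mem {c : ℂ} {b : K} (hb : b ∈ Oinf)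
    (h : algebraMap ℂ K c = x⁻¹ * b) : c = 0 := by
  by_contra hc
  have hc' : algebraMap ℂ K c ≠ 0 := by simpa using hc
  have : x ^ (1 : ℤ) ∈ Oinf := by
    have e : x ^ (1 : ℤ) = algebraMap ℂ K c⁻¹ * b := by
      rw [zpow_one, map_inv₀, eq_inv_mul_iff_mul_eq₀ hc', h]
      field_simp [x_ne_zero]
    rw [e]
    exact mul_mem (Oinf.algebraMap_mem _) hb
  have := zpow_mem_Oinf.1 this
  omega

instance : IsPrincipalIdealRing O₀ := isPrincipalIdealRing_adjoin transcendental_x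

instance : IsPrincipalIdealRing Oinf := isPrincipalIdealRing_adjoin transcendental_x_inv

instance : IsFractionRing O₀ K := IsFractionRing.of_field O₀ K fun z => by
  induction z using RatFunc.induction_on with
  | f p q hq => exact ⟨⟨_, polynomial_mem_O₀ p⟩, ⟨_, polynomial_mem_O₀ q⟩, rfl⟩

instance : IsFractionRing Oinf K := IsFractionRing.of_field Oinf K fun z => by
  induction z using RatFunc.induction_on with
  | f p q hq =>
    -- Numerator and denominator become regular at `∞` after multiplication by one common power of
    -- `x⁻¹`, which leaves the quotient unchanged.
    have h (r : Polynomial ℂ) : ∃ n : ℕ, x⁻¹ ^ n * algebraMap (Polynomial ℂ) K r ∈ Oinf :=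
      exists_pow_mul_mem (inv_ne_zero x_ne_zero) _ (by rw [inv_inv]; exact polynomial_mem_O₀ r)
    have h' (r : Polynomial ℂ) (n m : ℕ) (hr : x⁻¹ ^ n * algebraMap (Polynomial ℂ) K r ∈ Oinf) :
        x⁻¹ ^ (m + n) * algebraMap (Polynomial ℂ) K r ∈ Oinf := by
      rw [pow_add, mul_assoc]
      exact mul_mem (pow_mem x_inv_mem m) hr
    obtain ⟨n, hn⟩ := h p
    obtain ⟨m, hm⟩ := h q
    refine ⟨⟨_, h' p n m hn⟩, ⟨_, add_comm m n ▸ h' q m n hm⟩, ?_⟩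
    exact (mul_div_mul_left _ _ (pow_ne_zero _ (inv_ne_zero x_ne_zero))).symm

/-- A finitely generated module of rational functions over a principal ideal ring with fraction
field `ℂ(x)` is generated by one function. -/
theorem exists_eq_span_singleton {A : Subalgebra ℂ K} [IsPrincipalIdealRing A]
    [IsFractionRing A K] {J : Submodule A K} (hJ : J.FG) : ∃ g : K, J = Submodule.span A {g} := by
  obtain ⟨g, hg⟩ := (FractionalIdeal.isPrincipal
    (⟨J, FractionalIdeal.isFractional_of_fg hJ⟩ : FractionalIdeal (nonZeroDivisors A) K)).principal
  exact ⟨g, hg⟩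

/-! ### The derivation -/

theorem ddx_polynomial (p : Polynomial ℂ) : ddx (algebraMap (Polynomial ℂ) K p) =
    algebraMap (Polynomial ℂ) K (Polynomial.derivative p) := by
  have h := ddxFun_div p 1 one_ne_zero
  simp only [map_one, div_one, mul_one,
    Polynomial.derivative_one, mul_zero, sub_zero, one_pow] at h
  exact h

theorem ddx_x : ddx x = 1 := by
  simpa [RatFunc.algebraMap_X] using ddx_polynomial Polynomial.X

theorem ddx_zpow (d : ℤ) : ddx (x ^ d) = d * x ^ d * x⁻¹ := by
  rw [Derivation.leibniz_zpow, ddx_x]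
  simp [zpow_sub_one₀ x_ne_zero, mul_assoc]

theorem ddx_mem {a : K} (ha : a ∈ O₀) : ddx a ∈ O₀ := by
  obtain ⟨p, rfl⟩ := mem_O₀_iff.1 ha
  rw [ddx_polynomial]
  exact polynomial_mem_O₀ _

/-- With `y = x⁻¹`, the operator `x² d/dx` is `-d/dy`, which preserves polynomials in `y`. -/
theorem ddx_mem_inf {a : K} (ha : a ∈ Oinf) : x ^ 2 * ddx a ∈ Oinf := by
  induction ha using Algebra.adjoin_induction with
  | mem b hb =>
    rw [Set.mem_singleton_iff.1 hb, ← zpow_neg_one, ddx_zpow]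
    have : x ^ 2 * ((((-1 : ℤ) : K)) * x ^ (-1 : ℤ) * x⁻¹) = -1 := by
      rw [zpow_neg_one]
      field_simp [x_ne_zero]
      simp
    rw [this]
    exact neg_mem (one_mem _)
  | algebraMap c =>
    rw [Derivation.map_algebraMap, mul_zero]
    exact zero_mem _
  | add b c _ _ hb hc =>
    rw [map_add, mul_add]
    exact add_mem hb hc
  | mul b c hb' hc' hb hc =>
    rw [Derivation.leibniz, smul_eq_mul, smul_eq_mul, mul_add, mul_left_comm, mul_left_comm _ c]
    exact add_mem (mul_mem hb' hc) (mul_mem hc' hb)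

section

/-! ### Splittings of bundles of rank two -/

/-- The bundle `𝒪(m) ⊕ 𝒪(n)`. -/
abbrev splitBundle (m n : ℤ) : Bundle (K × K) := (lineBundle m).prod (lineBundle n)

theorem mem_lineBundle₀ {d : ℤ} {a : K} : a ∈ (lineBundle d).M₀ ↔ a ∈ O₀ := by
  constructor
  · intro h
    obtain ⟨g, rfl⟩ := Submodule.mem_span_singleton.1 h
    simp [Subalgebra.smul_def]
  · intro h
    exact Submodule.mem_span_singleton.2 ⟨⟨a, h⟩, by simp [Subalgebra.smul_def]⟩

theorem mem_lineBundleInf {d : ℤ} {a : K} :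
    a ∈ (lineBundle d).Minf ↔ x ^ (-d) * a ∈ Oinf := by
  have hx : x ^ d ≠ 0 := zpow_ne_zero _ x_ne_zero
  constructor
  · intro h
    obtain ⟨g, rfl⟩ := Submodule.mem_span_singleton.1 h
    have : x ^ (-d) * (g • x ^ d) = g := by
      rw [Subalgebra.smul_def, smul_eq_mul, zpow_neg]
      field_simp
    rw [this]
    exact g.2
  · intro h
    refine Submodule.mem_span_singleton.2 ⟨⟨_, h⟩, ?_⟩
    change x ^ (-d) * a * x ^ d = a
    rw [zpow_neg]
    field_simp

variable {V : Type*} [AddCommGroup V] [Module K V] [Module ℂ V] [IsScalarTower ℂ K V]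
variable {E : Bundle V} {m n : ℤ}

namespace Bundle.Iso

/-- Composition of isomorphisms. -/
def trans {W W' : Type*} [AddCommGroup W] [Module K W] [AddCommGroup W']
    [Module K W'] {F : Bundle W} {G : Bundle W'} (ψ : E.Iso F) (χ : F.Iso G) : E.Iso G where
  toEquiv := ψ.toEquiv.trans χ.toEquiv
  mem₀ v := (χ.mem₀ _).trans (ψ.mem₀ v)
  memInf v := (χ.memInf _).trans (ψ.memInf v)

theorem mem₀_iff (ψ : E.Iso (splitBundle m n)) {v : V} :
    v ∈ E.M₀ ↔ (ψ.toEquiv v).1 ∈ O₀ ∧ (ψ.toEquiv v).2 ∈ O₀ := by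
  rw [← ψ.mem₀ v, ← mem_lineBundle₀ (d := m), ← mem_lineBundle₀ (d := n)]
  rfl

theorem memInf_iff (ψ : E.Iso (splitBundle m n)) {v : V} :
    v ∈ E.Minf ↔ x ^ (-m) * (ψ.toEquiv v).1 ∈ Oinf ∧ x ^ (-n) * (ψ.toEquiv v).2 ∈ Oinf := by
  rw [← ψ.memInf v, ← mem_lineBundleInf, ← mem_lineBundleInf]
  rfl

/-- The sections over `x ≠ ∞` in terms of a splitting. -/
def sect (ψ : E.Iso (splitBundle m n)) : (O₀ × O₀) ≃ₗ[ℂ] E.sec₀ where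
  toFun g := ⟨ψ.toEquiv.symm (g.1, g.2), ψ.mem₀_iff.2 (by simp)⟩
  invFun s := (⟨(ψ.toEquiv s).1, (ψ.mem₀_iff.1 s.2).1⟩, ⟨(ψ.toEquiv s).2, (ψ.mem₀_iff.1 s.2).2⟩)
  map_add' g h := Subtype.ext (map_add ψ.toEquiv.symm ((g.1 : K), (g.2 : K)) (h.1, h.2))
  map_smul' c g := Subtype.ext
    (LinearMap.map_smul_of_tower ψ.toEquiv.symm.toLinearMap c ((g.1 : K), (g.2 : K)))
  left_inv g := by simp
  right_inv s := by simp

theorem coe_sect (ψ : E.Iso (splitBundle m n)) (g : O₀ × O₀) :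
    (ψ.sect g : V) = ψ.toEquiv.symm (g.1, g.2) := rfl

theorem toEquiv_sect (ψ : E.Iso (splitBundle m n)) (g : O₀ × O₀) :
    ψ.toEquiv (ψ.sect g) = ((g.1 : K), (g.2 : K)) := by
  rw [coe_sect, LinearEquiv.apply_symm_apply]

/-- The pair of values at `c` of a pair of functions. -/
def evPair (c : ℂ) : (O₀ × O₀) →ₗ[ℂ] ℂ × ℂ := (ev c).toLinearMap.prodMap (ev c).toLinearMap

/-- The factor theorem applied to each component: this makes the fibre at `c` isomorphic to `ℂ²`
through the pair of values. -/
theorem ker_evPair (ψ : E.Iso (splitBundle m n)) (c : ℂ) :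
    (evPair c).ker.map ψ.sect.toLinearMap = E.vanishing c := by
  ext s
  constructor
  · rintro ⟨g, hg, rfl⟩
    obtain ⟨h1, h2⟩ := Prod.ext_iff.1 (LinearMap.mem_ker.1 hg)
    obtain ⟨a, ha, ha'⟩ := exists_eq_of_ev_eq_zero h1
    obtain ⟨b, hb, hb'⟩ := exists_eq_of_ev_eq_zero h2
    refine ⟨ψ.sect (⟨a, ha⟩, ⟨b, hb⟩), Subtype.ext ?_⟩
    change xSub c • (ψ.sect (⟨a, ha⟩, ⟨b, hb⟩) : V) = ψ.sect g
    rw [coe_sect, coe_sect, ← map_smul]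
    exact congrArg ψ.toEquiv.symm (Prod.ext ha'.symm hb'.symm)
  · rintro ⟨s, rfl⟩
    obtain ⟨g, rfl⟩ := ψ.sect.surjective s
    have h0 : ev c ⟨xSub c, xSub_mem c⟩ = 0 := by
      have : (⟨xSub c, xSub_mem c⟩ : O₀) = X₀ - algebraMap ℂ O₀ c := rfl
      rw [this]
      simp
    refine ⟨(⟨xSub c, xSub_mem c⟩ * g.1, ⟨xSub c, xSub_mem c⟩ * g.2), ?_, Subtype.ext ?_⟩
    · refine LinearMap.mem_ker.2 (Prod.ext ?_ ?_)
      · change ev c (_ * g.1) = 0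
        rw [map_mul, h0, zero_mul]
      · change ev c (_ * g.2) = 0
        rw [map_mul, h0, zero_mul]
    · change (ψ.sect _ : V) = xSub c • (ψ.sect g : V)
      rw [coe_sect, coe_sect, ← map_smul]
      rfl

theorem evPair_surjective (c : ℂ) : Function.Surjective (evPair c) := fun z =>
  ⟨(algebraMap ℂ O₀ z.1, algebraMap ℂ O₀ z.2), Prod.ext
    ((ev c).commutes z.1) ((ev c).commutes z.2)⟩

/-- The coordinates on a fibre given by a splitting. -/
def coord (ψ : E.Iso (splitBundle m n)) (c : ℂ) : E.Fibre c ≃ₗ[ℂ] ℂ × ℂ :=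
  (Submodule.Quotient.equiv _ _ ψ.sect (ψ.ker_evPair c)).symm.trans
    ((evPair c).quotKerEquivOfSurjective (evPair_surjective c))

@[simp]
theorem coord_value (ψ : E.Iso (splitBundle m n)) (c : ℂ) (g : O₀ × O₀) :
    ψ.coord c (E.value c (ψ.sect g)) = (ev c g.1, ev c g.2) := by
  have : E.value c (ψ.sect g) = Submodule.Quotient.equiv _ _ ψ.sect (ψ.ker_evPair c)
    ((evPair c).ker.mkQ g) := rfl
  rw [this, coord, LinearEquiv.trans_apply, LinearEquiv.symm_apply_apply]
  rfl

theorem exists_sect (ψ : E.Iso (splitBundle m n)) (c : ℂ) (v : E.Fibre c) :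
    ∃ g, v = E.value c (ψ.sect g) := by
  obtain ⟨s, rfl⟩ := Submodule.mkQ_surjective _ v
  obtain ⟨g, rfl⟩ := ψ.sect.surjective s
  exact ⟨g, rfl⟩

/-- The section with constant coordinates through a point of a fibre. -/
theorem eq_value_const (ψ : E.Iso (splitBundle m n)) (c : ℂ) (v : E.Fibre c) :
    v = E.value c (ψ.sect (algebraMap ℂ O₀ (ψ.coord c v).1, algebraMap ℂ O₀ (ψ.coord c v).2)) :=
  (ψ.coord c).injective (by simp)

theorem fibre_value {W : Type*} [AddCommGroup W] [Module K W] [Module ℂ W] [IsScalarTower ℂ K W]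
    {F : Bundle W} (φ : E.Hom F) (c : ℂ) (s : E.sec₀) :
    φ.fibre c (E.value c s) = F.value c (φ.sections s) := rfl

end Bundle.Iso

/-- The line in `ℂ²` with coordinate `u`. -/
def ell (u : OnePoint ℂ) : Submodule ℂ (ℂ × ℂ) :=
  u.elim (LinearMap.fst ℂ ℂ ℂ).ker
    fun a => (LinearMap.snd ℂ ℂ ℂ - a • LinearMap.fst ℂ ℂ ℂ).ker

theorem mem_ell_infty {z : ℂ × ℂ} : z ∈ ell ∞ ↔ z.1 = 0 := Iff.rfl

theorem mem_ell_coe {a : ℂ} {z : ℂ × ℂ} : z ∈ ell (a : OnePoint ℂ) ↔ z.2 = a * z.1 := by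
  change z ∈ (LinearMap.snd ℂ ℂ ℂ - a • LinearMap.fst ℂ ℂ ℂ).ker ↔ _
  rw [LinearMap.mem_ker]
  simp [sub_eq_zero]

theorem ell_infty_eq : ell ∞ = ℂ ∙ ((0, 1) : ℂ × ℂ) := by
  ext z
  rw [mem_ell_infty, Submodule.mem_span_singleton]
  constructor
  · intro h
    exact ⟨z.2, Prod.ext (by simp [h]) (by simp)⟩
  · rintro ⟨a, rfl⟩
    simp

theorem ell_coe_eq (a : ℂ) : ell (a : OnePoint ℂ) = ℂ ∙ ((1, a) : ℂ × ℂ) := by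
  ext z
  rw [mem_ell_coe, Submodule.mem_span_singleton]
  constructor
  · intro h
    exact ⟨z.1, Prod.ext (by simp) (by simp [h, mul_comm])⟩
  · rintro ⟨a, rfl⟩
    simp [mul_comm]

/-- Every line in `ℂ²` has a coordinate. -/
theorem exists_eq_ell {L : Submodule ℂ (ℂ × ℂ)} (hL : Module.finrank ℂ L = 1) :
    ∃ u, L = ell u := by
  obtain ⟨⟨⟨a, b⟩, hv⟩, hv0, hspan⟩ := finrank_eq_one_iff'.1 hL
  have hL' : L = ℂ ∙ (a, b) := by
    refine le_antisymm (fun w hw => ?_) ((Submodule.span_singleton_le_iff_mem _ _).2 hv)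
    obtain ⟨c, hc⟩ := hspan ⟨w, hw⟩
    exact Submodule.mem_span_singleton.2 ⟨c, congrArg Subtype.val hc⟩
  by_cases ha : a = 0
  · have hb : b ≠ 0 := fun hb => hv0 (Subtype.ext (by simp [ha, hb]))
    refine ⟨∞, hL'.trans ?_⟩
    rw [ell_infty_eq, ha, ← Submodule.span_singleton_smul_eq (IsUnit.mk0 b hb) (0, 1)]
    simp
  · refine ⟨((b / a : ℂ) : OnePoint ℂ), hL'.trans ?_⟩
    rw [ell_coe_eq, ← Submodule.span_singleton_smul_eq (IsUnit.mk0 a ha) (1, b / a)]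
    simp [mul_div_cancel₀ _ ha]

variable {N : ℕ} {t : Fin N → ℂ}

/-- In the given splitting the quasi-parabolic structure has coordinates `u`. -/
def HasCoords (P : QuasiParabolic t E) (ψ : E.Iso (splitBundle m n)) (u : Fin N → OnePoint ℂ) :
    Prop :=
  ∀ i v, v ∈ P.line i ↔ ψ.coord (t i) v ∈ ell (u i)

theorem exists_hasCoords (P : QuasiParabolic t E) (ψ : E.Iso (splitBundle m n)) :
    ∃ u, HasCoords P ψ u := by
  have h (i : Fin N) : ∃ u, (P.line i).map (ψ.coord (t i)).toLinearMap = ell u :=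
    exists_eq_ell ((LinearEquiv.finrank_map_eq (ψ.coord (t i)) (P.line i)).trans
      (P.finrank_line i))
  choose u hu using h
  refine ⟨u, fun i v => ?_⟩
  rw [← hu i]
  constructor
  · exact fun hv => ⟨v, hv, rfl⟩
  · rintro ⟨w, hw, hwv⟩
    rwa [← (ψ.coord (t i)).injective hwv]

end

section

variable {V : Type*} [AddCommGroup V] [Module K V] [Module ℂ V] [IsScalarTower ℂ K V]
variable {E : Bundle V} {m n : ℤ} {N : ℕ} {t : Fin N → ℂ}

/-! ### Decomposable quasi-parabolic bundles -/

/-- A function without zeros and poles on `x ≠ 0, ∞` is a monomial. -/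
theorem eq_monomial_of_unit {h k : K} {n l : ℕ} (hl : x ^ l * h ∈ O₀) (hk : k ∈ Oinf)
    (hhk : k * h = x⁻¹ ^ n) : ∃ c : ℂ, c ≠ 0 ∧ ∃ d : ℤ, h = algebraMap ℂ K c * x ^ d := by
  obtain ⟨P, hP⟩ := mem_O₀_iff.1 hl
  obtain ⟨j, hj⟩ := exists_pow_mul_mem x_ne_zero k hk
  obtain ⟨Q, hQ⟩ := mem_O₀_iff.1 hj
  -- After the poles at `0` are cleared, the relation exhibits `P` as a divisor of a power of the
  -- prime `X`, so `P` is a constant times a power of `X`.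
  have hPQ : P * (Q * Polynomial.X ^ n) = Polynomial.X ^ (j + l) := by
    apply RatFunc.algebraMap_injective ℂ
    simp only [map_mul, map_pow, RatFunc.algebraMap_X, hP, hQ]
    have : x ^ l * h * (x ^ j * k * x ^ n) = x ^ (j + l) * (k * h * x ^ n) := by ring
    rw [this, hhk, ← mul_pow, inv_mul_cancel₀ x_ne_zero, one_pow, mul_one]
  obtain ⟨r, -, w, hw⟩ := (dvd_prime_pow Polynomial.prime_X _).1 ⟨_, hPQ.symm⟩
  obtain ⟨c, hc, hcw⟩ := Polynomial.isUnit_iff.1 w.isUnit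
  have hc0 : c ≠ 0 := hc.ne_zero
  have hcK : algebraMap ℂ K c ≠ 0 := by simpa using hc0
  refine ⟨c⁻¹, inv_ne_zero hc0, (r : ℤ) - l, ?_⟩
  have e : x ^ l * h * algebraMap ℂ K c = x ^ r := by
    have := congrArg (algebraMap (Polynomial ℂ) K) hw
    rw [← hcw, map_mul, map_pow, RatFunc.algebraMap_X, hP] at this
    exact this
  rw [map_inv₀, zpow_sub₀ x_ne_zero, zpow_natCast, zpow_natCast, ← e]
  field_simp [x_ne_zero]

/-- Every line subbundle is isomorphic to some `𝒪(d)`. -/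
theorem exists_generator (E : Bundle V) {S : Submodule K V} (hS : Module.finrank K S = 1) :
    ∃ s : V, ∃ d : ℤ, s ≠ 0 ∧ S = K ∙ s ∧ (∀ a : K, a • s ∈ E.M₀ ↔ a ∈ O₀) ∧
      ∀ a : K, a • s ∈ E.Minf ↔ x ^ (-d) * a ∈ Oinf := by
  obtain ⟨⟨s₀, hs₀⟩, hne, hspan⟩ := finrank_eq_one_iff'.1 hS
  have hs₀0 : s₀ ≠ 0 := fun h => hne (Subtype.ext h)
  have hSs : S = K ∙ s₀ := by
    refine le_antisymm (fun w hw => ?_) ((Submodule.span_singleton_le_iff_mem _ _).2 hs₀)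
    obtain ⟨c, hc⟩ := hspan ⟨w, hw⟩
    exact Submodule.mem_span_singleton.2 ⟨c, congrArg Subtype.val hc⟩
  have hfg₀ (s : V) (hs : s ≠ 0) :
      (E.M₀.comap ((LinearMap.toSpanSingleton K V s).restrictScalars O₀)).FG := by
    have : IsNoetherian O₀ E.M₀ := isNoetherian_of_fg_of_noetherian _ E.fg₀
    refine Submodule.fg_of_fg_map_injective ((LinearMap.toSpanSingleton K V s).restrictScalars O₀)
      (fun a b hab => smul_left_injective K hs hab) ?_
    exact Submodule.FG.of_le E.fg₀ (Submodule.map_comap_le _ _)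
  have hfgInf (s : V) (hs : s ≠ 0) :
      (E.Minf.comap ((LinearMap.toSpanSingleton K V s).restrictScalars Oinf)).FG := by
    have : IsNoetherian Oinf E.Minf := isNoetherian_of_fg_of_noetherian _ E.fgInf
    refine Submodule.fg_of_fg_map_injective ((LinearMap.toSpanSingleton K V s).restrictScalars Oinf)
      (fun a b hab => smul_left_injective K hs hab) ?_
    exact Submodule.FG.of_le E.fgInf (Submodule.map_comap_le _ _)
  obtain ⟨g, hg⟩ := exists_eq_span_singleton (hfg₀ s₀ hs₀0)
  have hg' (a : K) : a • s₀ ∈ E.M₀ ↔ ∃ b : O₀, b • g = a := by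
    rw [← Submodule.mem_span_singleton, ← hg]
    rfl
  have hg0 : g ≠ 0 := by
    rintro rfl
    obtain ⟨a, ha, has⟩ := E.generate s₀
    obtain ⟨b, hb⟩ := (hg' a).1 has
    exact ha (Subtype.ext (hb.symm.trans (smul_zero b)))
  have hs : g • s₀ ≠ 0 := smul_ne_zero hg0 hs₀0
  have hmem₀ (a : K) : a • g • s₀ ∈ E.M₀ ↔ a ∈ O₀ := by
    rw [smul_smul, hg']
    constructor
    · rintro ⟨b, hb⟩
      rw [← mul_right_cancel₀ hg0 hb]
      exact b.2
    · exact fun ha => ⟨⟨a, ha⟩, rfl⟩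
  obtain ⟨h, hh⟩ := exists_eq_span_singleton (hfgInf _ hs)
  have hh' (a : K) : a • g • s₀ ∈ E.Minf ↔ ∃ b : Oinf, b • h = a := by
    rw [← Submodule.mem_span_singleton, ← hh]
    rfl
  -- The generators over the two charts are `g • s₀` and `h • g • s₀`. Gluing in both directions
  -- makes `h` a unit away from `0` and `∞`, hence a monomial, and its exponent is the degree of the
  -- line bundle.
  obtain ⟨n, hn⟩ := E.glue₀ _ (by simpa using (hmem₀ 1).2 (one_mem _))
  obtain ⟨k, hk⟩ := (hh' _).1 hn
  obtain ⟨l, hl⟩ := E.glueInf _ ((hh' h).2 ⟨1, one_smul _ _⟩)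
  rw [smul_smul, hmem₀] at hl
  obtain ⟨c, hc, d, rfl⟩ := eq_monomial_of_unit hl k.2 hk
  have hcK : algebraMap ℂ K c ≠ 0 := by simpa using hc
  refine ⟨g • s₀, d, hs, ?_, hmem₀, fun a => ?_⟩
  · rw [hSs, Submodule.span_singleton_smul_eq (IsUnit.mk0 g hg0)]
  · rw [hh']
    have hx : x ^ d ≠ 0 := zpow_ne_zero _ x_ne_zero
    constructor
    · rintro ⟨b, rfl⟩
      have : x ^ (-d) * (b • (algebraMap ℂ K c * x ^ d)) = algebraMap ℂ K c * b := by
        rw [Subalgebra.smul_def, smul_eq_mul, zpow_neg]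
        field_simp
      rw [this]
      exact mul_mem (Oinf.algebraMap_mem c) b.2
    · intro ha
      refine ⟨⟨_, mul_mem (Oinf.algebraMap_mem c⁻¹) ha⟩, ?_⟩
      change algebraMap ℂ K c⁻¹ * (x ^ (-d) * a) * (algebraMap ℂ K c * x ^ d) = a
      rw [map_inv₀, zpow_neg]
      field_simp

theorem mem_subFibre {S : Submodule K V} {c : ℂ} {v : E.Fibre c} :
    v ∈ E.subFibre S c ↔ ∃ s : E.sec₀, (s : V) ∈ S ∧ E.value c s = v := by
  constructor
  · rintro ⟨w, rfl⟩
    obtain ⟨s, rfl⟩ := Submodule.mkQ_surjective _ w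
    exact ⟨(E.incl S).sections s, s.1.2, rfl⟩
  · rintro ⟨s, hs, rfl⟩
    exact ⟨(E.sub S).value c ⟨⟨s, hs⟩, s.2⟩, rfl⟩

/-- A decomposition gives a splitting in which all lines are the coordinate axes. -/
theorem exists_split_of_isDecomposition (hV : Module.finrank K V = 2) {P : QuasiParabolic t E}
    {S₁ S₂ : Submodule K V} (h : P.IsDecomposition S₁ S₂) (h₁ : S₁ ≠ ⊥) (h₂ : S₂ ≠ ⊥) :
    ∃ (m n : ℤ) (ψ : E.Iso (splitBundle m n)) (u : Fin N → OnePoint ℂ),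
      HasCoords P ψ u ∧ ∀ i, u i = (0 : ℂ) ∨ u i = ∞ := by
  obtain ⟨hc, hd₀, hdInf, hline⟩ := h
  have : FiniteDimensional K V := Module.finite_of_finrank_eq_succ hV
  have hsum := Submodule.finrank_add_eq_of_isCompl hc
  have hp₁ : Module.finrank K S₁ ≠ 0 := fun h => h₁ (Submodule.finrank_eq_zero.1 h)
  have hp₂ : Module.finrank K S₂ ≠ 0 := fun h => h₂ (Submodule.finrank_eq_zero.1 h)
  obtain ⟨s₁, m, hs₁, rfl, hm₀, hmInf⟩ := exists_generator E (S := S₁) (by omega)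
  obtain ⟨s₂, n, hs₂, rfl, hn₀, hnInf⟩ := exists_generator E (S := S₂) (by omega)
  have huniq {a b : K} {v₁ v₂ : V} (hv₁ : v₁ ∈ K ∙ s₁) (hv₂ : v₂ ∈ K ∙ s₂)
      (e : a • s₁ + b • s₂ = v₁ + v₂) : v₁ = a • s₁ ∧ v₂ = b • s₂ := by
    have e' : v₁ - a • s₁ = b • s₂ - v₂ := by
      rw [sub_eq_sub_iff_add_eq_add, ← e, add_comm]
    have hmem : v₁ - a • s₁ ∈ (K ∙ s₁) ⊓ (K ∙ s₂) :=
      ⟨sub_mem hv₁ (Submodule.smul_mem _ _ (Submodule.mem_span_singleton_self _)),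
        e' ▸ sub_mem (Submodule.smul_mem _ _ (Submodule.mem_span_singleton_self _)) hv₂⟩
    rw [hc.inf_eq_bot, Submodule.mem_bot] at hmem
    exact ⟨sub_eq_zero.1 hmem, (sub_eq_zero.1 (e'.symm.trans hmem)).symm⟩
  let f : K × K →ₗ[K] V :=
    (LinearMap.toSpanSingleton K V s₁).coprod (LinearMap.toSpanSingleton K V s₂)
  have hf (a b : K) : f (a, b) = a • s₁ + b • s₂ := rfl
  have hbij : Function.Bijective f := by
    constructor
    · rintro ⟨a, b⟩ ⟨a', b'⟩ e
      rw [hf, hf] at e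
      obtain ⟨e₁, e₂⟩ := huniq (Submodule.smul_mem _ a' (Submodule.mem_span_singleton_self _))
        (Submodule.smul_mem _ b' (Submodule.mem_span_singleton_self _)) e
      exact Prod.ext (smul_left_injective K hs₁ e₁.symm) (smul_left_injective K hs₂ e₂.symm)
    · intro v
      have hv : v ∈ (K ∙ s₁) ⊔ (K ∙ s₂) := by rw [hc.sup_eq_top]; trivial
      obtain ⟨v₁, hv₁, v₂, hv₂, rfl⟩ := Submodule.mem_sup.1 hv
      obtain ⟨a, rfl⟩ := Submodule.mem_span_singleton.1 hv₁
      obtain ⟨b, rfl⟩ := Submodule.mem_span_singleton.1 hv₂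
      exact ⟨(a, b), rfl⟩
  let e := LinearEquiv.ofBijective f hbij
  have he (z : K × K) : e z = z.1 • s₁ + z.2 • s₂ := rfl
  let ψ : E.Iso (splitBundle m n) :=
    { toEquiv := e.symm
      mem₀ := by
        intro v
        obtain ⟨⟨a, b⟩, rfl⟩ := e.surjective v
        rw [LinearEquiv.symm_apply_apply, he]
        refine (and_congr mem_lineBundle₀ mem_lineBundle₀ : _ ↔ a ∈ O₀ ∧ b ∈ O₀).trans ?_
        rw [← hm₀, ← hn₀]
        refine ⟨fun h => add_mem h.1 h.2, fun h => ?_⟩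
        obtain ⟨v₁, hv₁, v₂, hv₂, hv₁', hv₂', e⟩ := hd₀ _ h
        obtain ⟨rfl, rfl⟩ := huniq hv₁ hv₂ e
        exact ⟨hv₁', hv₂'⟩
      memInf := by
        intro v
        obtain ⟨⟨a, b⟩, rfl⟩ := e.surjective v
        rw [LinearEquiv.symm_apply_apply, he]
        refine (and_congr mem_lineBundleInf mem_lineBundleInf :
          _ ↔ x ^ (-m) * a ∈ Oinf ∧ x ^ (-n) * b ∈ Oinf).trans ?_
        rw [← hmInf, ← hnInf]
        refine ⟨fun h => add_mem h.1 h.2, fun h => ?_⟩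
        obtain ⟨v₁, hv₁, v₂, hv₂, hv₁', hv₂', e⟩ := hdInf _ h
        obtain ⟨rfl, rfl⟩ := huniq hv₁ hv₂ e
        exact ⟨hv₁', hv₂'⟩ }
  obtain ⟨u, hu⟩ := exists_hasCoords P ψ
  refine ⟨m, n, ψ, u, hu, fun i => ?_⟩
  have hψ₁ : ψ.toEquiv s₁ = (1, 0) := e.symm_apply_eq.2 (by simp [he])
  have hψ₂ : ψ.toEquiv s₂ = (0, 1) := e.symm_apply_eq.2 (by simp [he])
  have hsub₁ {v : E.Fibre (t i)} (hv : v ∈ E.subFibre (K ∙ s₁) (t i)) :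
      (ψ.coord (t i) v).2 = 0 := by
    obtain ⟨s, hs, rfl⟩ := mem_subFibre.1 hv
    obtain ⟨g, rfl⟩ := ψ.sect.surjective s
    obtain ⟨a, ha⟩ := Submodule.mem_span_singleton.1 hs
    have : g.2 = 0 := Subtype.ext (by
      have := congrArg Prod.snd (congrArg ψ.toEquiv ha)
      rw [map_smul, hψ₁, ψ.toEquiv_sect] at this
      simpa using this.symm)
    simp [this]
  have hsub₂ {v : E.Fibre (t i)} (hv : v ∈ E.subFibre (K ∙ s₂) (t i)) :
      (ψ.coord (t i) v).1 = 0 := by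
    obtain ⟨s, hs, rfl⟩ := mem_subFibre.1 hv
    obtain ⟨g, rfl⟩ := ψ.sect.surjective s
    obtain ⟨a, ha⟩ := Submodule.mem_span_singleton.1 hs
    have : g.1 = 0 := Subtype.ext (by
      have := congrArg Prod.fst (congrArg ψ.toEquiv ha)
      rw [map_smul, hψ₂, ψ.toEquiv_sect] at this
      simpa using this.symm)
    simp [this]
  -- A spanning vector of the line is a sum `v₁ + v₂` of vectors on the two axes that both belong to
  -- the line.
  obtain ⟨⟨v, hv⟩, hv0, -⟩ := finrank_eq_one_iff'.1 (P.finrank_line i)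
  have hv0' : v ≠ 0 := fun h => hv0 (Subtype.ext h)
  have hv' := hv
  rw [hline i] at hv'
  obtain ⟨v₁, ⟨hv₁, hv₁'⟩, v₂, ⟨hv₂, hv₂'⟩, rfl⟩ := Submodule.mem_sup.1 hv'
  have hz₁ := hsub₁ hv₁'
  have hz₂ := hsub₂ hv₂'
  rw [SetLike.mem_coe, hu i] at hv₁ hv₂
  generalize hui : u i = w at hv₁ hv₂
  cases w using OnePoint.rec with
  | infty => exact Or.inr rfl
  | coe a =>
    left
    -- A line with finite coordinate contains no nonzero vector with first coordinate `0`, so `v₂ =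
    -- 0`. Then `v₁` spans the line and lies on the first axis, which forces `a = 0`.
    rw [mem_ell_coe] at hv₁ hv₂
    rw [hz₂, mul_zero] at hv₂
    have hv₂0 : v₂ = 0 := (ψ.coord (t i)).injective (by
      rw [map_zero]; exact Prod.ext hz₂ hv₂)
    have h1 : (ψ.coord (t i) v₁).1 ≠ 0 := fun h1 => hv0' (by
      rw [hv₂0, add_zero]
      exact (ψ.coord (t i)).injective (by rw [map_zero]; exact Prod.ext h1 hz₁))
    rw [hz₁] at hv₁
    rw [(mul_eq_zero.1 hv₁.symm).resolve_right h1]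

/-- A quasi-parabolic bundle is decomposable if, in some splitting, all lines are coordinate
axes. -/
theorem not_indecomposable_of_split {P : QuasiParabolic t E} {ψ : E.Iso (splitBundle m n)}
    {u : Fin N → OnePoint ℂ} (hu : HasCoords P ψ u) (h : ∀ i, u i = (0 : ℂ) ∨ u i = ∞) :
    ¬ P.Indecomposable := by
  intro hI
  let S₁ : Submodule K V := (LinearMap.snd K K K ∘ₗ ψ.toEquiv.toLinearMap).ker
  let S₂ : Submodule K V := (LinearMap.fst K K K ∘ₗ ψ.toEquiv.toLinearMap).ker
  have hS₁ {v : V} : v ∈ S₁ ↔ (ψ.toEquiv v).2 = 0 := Iff.rfl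
  have hS₂ {v : V} : v ∈ S₂ ↔ (ψ.toEquiv v).1 = 0 := Iff.rfl
  have hsplit (v : V) : v = ψ.toEquiv.symm ((ψ.toEquiv v).1, 0) +
      ψ.toEquiv.symm (0, (ψ.toEquiv v).2) := by
    rw [← map_add]
    simp
  have hdec : P.IsDecomposition S₁ S₂ := by
    refine ⟨⟨?_, ?_⟩, fun v hv => ?_, fun v hv => ?_, fun i => ?_⟩
    · rw [Submodule.disjoint_def]
      intro v h₁ h₂
      exact ψ.toEquiv.injective (by rw [map_zero]; exact Prod.ext (hS₂.1 h₂) (hS₁.1 h₁))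
    · rw [codisjoint_iff, eq_top_iff]
      intro v _
      rw [hsplit v]
      exact Submodule.add_mem_sup (hS₁.2 (by simp)) (hS₂.2 (by simp))
    · rw [ψ.mem₀_iff] at hv
      exact ⟨_, hS₁.2 (by simp), _, hS₂.2 (by simp), ψ.mem₀_iff.2 (by simpa using hv.1),
        ψ.mem₀_iff.2 (by simpa using hv.2), hsplit v⟩
    · rw [ψ.memInf_iff] at hv
      exact ⟨_, hS₁.2 (by simp), _, hS₂.2 (by simp), ψ.memInf_iff.2 (by simpa using hv.1),
        ψ.memInf_iff.2 (by simpa using hv.2), hsplit v⟩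
    · refine le_antisymm (fun v hv => ?_) (sup_le inf_le_left inf_le_left)
      have hv' := (hu i v).1 hv
      rcases h i with h | h
      · refine Submodule.mem_sup_left ⟨hv, mem_subFibre.2 ⟨_, ?_, (ψ.eq_value_const _ v).symm⟩⟩
        rw [h, mem_ell_coe, zero_mul] at hv'
        rw [hS₁, ψ.toEquiv_sect, hv']
        simp
      · refine Submodule.mem_sup_right ⟨hv, mem_subFibre.2 ⟨_, ?_, (ψ.eq_value_const _ v).symm⟩⟩
        rw [h, mem_ell_infty] at hv'
        rw [hS₂, ψ.toEquiv_sect, hv']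
        simp
  rcases hI.2 S₁ S₂ hdec with h | h
  · have : ψ.toEquiv.symm (1, 0) ∈ S₁ := hS₁.2 (by simp)
    rw [h, Submodule.mem_bot, LinearEquiv.symm_apply_eq, map_zero] at this
    exact one_ne_zero (congrArg Prod.fst this)
  · have : ψ.toEquiv.symm (0, 1) ∈ S₂ := hS₂.2 (by simp)
    rw [h, Submodule.mem_bot, LinearEquiv.symm_apply_eq, map_zero] at this
    exact one_ne_zero (congrArg Prod.snd this)

/-- Simple quasi-parabolic bundles are indecomposable. -/
theorem indecomposable_of_simple [Nontrivial V] {P : QuasiParabolic t E} (h : P.Simple) :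
    P.Indecomposable := by
  refine ⟨inferInstance, fun S₁ S₂ ⟨hc, hd₀, hdInf, hline⟩ => ?_⟩
  -- The projection onto `S₁` along `S₂` preserves the bundle and the lines, so it is a scalar `c`.
  -- It is the identity on `S₁` and zero on `S₂`, hence `S₁ = ⊥` if `c = 0`, and `S₂ = ⊥` otherwise.
  let p : V →ₗ[K] V := S₁.subtype ∘ₗ S₁.projectionOnto S₂ hc
  have hp₁ {v : V} (hv : v ∈ S₁) : p v = v :=
    congrArg Subtype.val (Submodule.projectionOnto_apply_left hc ⟨v, hv⟩)
  have hp₂ {v : V} (hv : v ∈ S₂) : p v = 0 :=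
    congrArg Subtype.val (Submodule.projectionOnto_apply_right hc ⟨v, hv⟩)
  let φ : E.Hom E :=
    { toLin := p
      map₀ := fun v hv => by
        obtain ⟨v₁, h₁, v₂, h₂, h₁', h₂', rfl⟩ := hd₀ v hv
        rwa [map_add, hp₁ h₁, hp₂ h₂, add_zero]
      mapInf := fun v hv => by
        obtain ⟨v₁, h₁, v₂, h₂, h₁', h₂', rfl⟩ := hdInf v hv
        rwa [map_add, hp₁ h₁, hp₂ h₂, add_zero] }
  have hφ (i : Fin N) (v) (hv : v ∈ P.line i) : φ.fibre (t i) v ∈ P.line i := by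
    rw [hline i] at hv
    obtain ⟨v₁, ⟨hv₁, hv₁'⟩, v₂, ⟨hv₂, hv₂'⟩, rfl⟩ := Submodule.mem_sup.1 hv
    obtain ⟨s₁, hs₁, rfl⟩ := mem_subFibre.1 hv₁'
    obtain ⟨s₂, hs₂, rfl⟩ := mem_subFibre.1 hv₂'
    have e₁ : φ.sections s₁ = s₁ := Subtype.ext (hp₁ hs₁)
    have e₂ : φ.sections s₂ = 0 := Subtype.ext (hp₂ hs₂)
    rwa [map_add, Bundle.Iso.fibre_value, Bundle.Iso.fibre_value, e₁, e₂, map_zero, add_zero]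
  obtain ⟨c, hc'⟩ := h φ hφ
  by_cases hc0 : c = 0
  · left
    rw [Submodule.eq_bot_iff]
    intro v hv
    rw [← hp₁ hv]
    exact (hc' v).trans (by rw [hc0, zero_smul])
  · right
    rw [Submodule.eq_bot_iff]
    intro v hv
    have := (hc' v).symm.trans (hp₂ hv)
    rw [← algebraMap_smul K c v] at this
    exact (smul_eq_zero.1 this).resolve_left (by simpa using hc0)

end

section

variable {V : Type*} [AddCommGroup V] [Module K V] [Module ℂ V] [IsScalarTower ℂ K V]
variable {E : Bundle V}

/-! ### The splitting theorem for bundles of rank two and degree one -/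

/-- `e` gives coordinates for which the sections over `x ≠ 0` are the pairs of functions. -/
def IsFrameInf (E : Bundle V) (e : V ≃ₗ[K] K × K) : Prop :=
  ∀ v, v ∈ E.Minf ↔ (e v).1 ∈ Oinf ∧ (e v).2 ∈ Oinf

/-- The sections `a`, `b` form a frame over `x ≠ ∞`, with poles at `∞` bounded by `-m`, `-n`, and
their determinant is that of a bundle of degree one. -/
structure IsAdapted (E : Bundle V) (e : V ≃ₗ[K] K × K) (a b : V) (m n : ℤ) : Prop where
  span : E.M₀ = Submodule.span O₀ {a, b}
  det : ∃ c : ℂ, c ≠ 0 ∧ (e a).1 * (e b).2 - (e a).2 * (e b).1 = algebraMap ℂ K c * x⁻¹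
  left : x ^ m • a ∈ E.Minf
  right : x ^ n • b ∈ E.Minf

namespace IsAdapted

variable {e : V ≃ₗ[K] K × K} {a b : V} {m n : ℤ}

theorem symm (h : IsAdapted E e a b m n) : IsAdapted E e b a n m where
  span := by rw [h.span, Set.pair_comm]
  det := by
    obtain ⟨c, hc, hd⟩ := h.det
    refine ⟨-c, neg_ne_zero.2 hc, ?_⟩
    rw [map_neg, neg_mul, ← hd]
    ring
  left := h.right
  right := h.left

/-- The rescaled sections are regular at `∞`, and the exponent measures their failure to be a frame
there: the determinant vanishes at `∞` if `m + n < 1` and is a nonzero constant if `m + n = 1`. -/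
theorem det_smul (h : IsAdapted E e a b m n) : ∃ c : ℂ, c ≠ 0 ∧
    (e (x ^ m • a)).1 * (e (x ^ n • b)).2 - (e (x ^ m • a)).2 * (e (x ^ n • b)).1 =
      algebraMap ℂ K c * x ^ (m + n - 1) := by
  obtain ⟨c, hc, hd⟩ := h.det
  refine ⟨c, hc, ?_⟩
  rw [zpow_sub_one₀ x_ne_zero, zpow_add₀ x_ne_zero, mul_left_comm, ← hd, map_smul, map_smul]
  simp only [Prod.smul_fst, Prod.smul_snd, smul_eq_mul]
  ring

/-- The reduction step of Birkhoff–Grothendieck. Since `m + n < 1`, the values at `∞` of `x ^ m • a`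
and `x ^ n • b` are linearly dependent. Either the first is zero and `m` can be raised, or the
second is `l` times the first; then replacing `b` by `b - l x ^ (m - n) a` allows `n` to be raised.
The hypothesis `n ≤ m` makes the multiplier a polynomial, so the span over `x ≠ ∞` is unchanged. -/
theorem exists_add_one_of_le (he : IsFrameInf E e) (h : IsAdapted E e a b m n) (hmn : m + n < 1)
    (hle : n ≤ m) : ∃ a' b' m' n', IsAdapted E e a' b' m' n' ∧ m' + n' = m + n + 1 := by
  obtain ⟨c, hc, hd⟩ := h.det_smul
  obtain ⟨ha₁, ha₂⟩ := (he _).1 h.left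
  obtain ⟨hb₁, hb₂⟩ := (he _).1 h.right
  obtain ⟨α₁, f₁, hf₁, hα₁⟩ := exists_value_inf ha₁
  obtain ⟨α₂, f₂, hf₂, hα₂⟩ := exists_value_inf ha₂
  obtain ⟨β₁, g₁, hg₁, hβ₁⟩ := exists_value_inf hb₁
  obtain ⟨β₂, g₂, hg₂, hβ₂⟩ := exists_value_inf hb₂
  have hx := x_ne_zero
  have hdet : α₁ * β₂ - α₂ * β₁ = 0 := by
    rw [hα₁, hα₂, hβ₁, hβ₂] at hd
    have hz : x ^ (m + n - 1) = x⁻¹ * x ^ (m + n) := by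
      rw [zpow_sub_one₀ hx, mul_comm]
    -- The witness collects all terms of the expanded determinant identity, other than the
    -- determinant of the values at `∞`, after the common factor `x⁻¹` is taken out.
    refine const_eq_zero_of_mem (b := algebraMap ℂ K c * x ^ (m + n) -
      (algebraMap ℂ K α₁ * g₂ + f₁ * algebraMap ℂ K β₂ + x⁻¹ * f₁ * g₂ -
        algebraMap ℂ K α₂ * g₁ - f₂ * algebraMap ℂ K β₁ - x⁻¹ * f₂ * g₁)) ?_ ?_
    · have hA (z : ℂ) : algebraMap ℂ K z ∈ Oinf := Oinf.algebraMap_mem z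
      have hy := x_inv_mem
      have hp : x ^ (m + n) ∈ Oinf := zpow_mem_Oinf.2 (by omega)
      exact sub_mem (mul_mem (hA _) hp) (sub_mem (sub_mem (sub_mem (add_mem (add_mem
        (mul_mem (hA _) hg₂) (mul_mem hf₁ (hA _))) (mul_mem (mul_mem hy hf₁) hg₂))
        (mul_mem (hA _) hg₁)) (mul_mem hf₂ (hA _))) (mul_mem (mul_mem hy hf₂) hg₁))
    · rw [hz] at hd
      rw [map_sub, map_mul, map_mul]
      linear_combination hd
  have hshift {z : K} : x * (0 + x⁻¹ * z) = z := by
    field_simp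
    ring
  by_cases hα : α₁ = 0 ∧ α₂ = 0
  · refine ⟨a, b, m + 1, n, ⟨h.span, h.det, ?_, h.right⟩, by ring⟩
    rw [zpow_add_one₀ hx, mul_comm, mul_smul, he, map_smul, Prod.smul_fst, Prod.smul_snd, hα₁, hα₂,
      hα.1, hα.2, map_zero, smul_eq_mul, smul_eq_mul, hshift, hshift]
    exact ⟨hf₁, hf₂⟩
  · obtain ⟨l, hl₁, hl₂⟩ : ∃ l, β₁ = l * α₁ ∧ β₂ = l * α₂ := by
      by_cases h1 : α₁ = 0
      · have h2 : α₂ ≠ 0 := fun h2 => hα ⟨h1, h2⟩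
        refine ⟨β₂ / α₂, ?_, by field_simp⟩
        rw [h1, zero_mul, zero_sub, neg_eq_zero] at hdet
        rw [h1, mul_zero, (mul_eq_zero.1 hdet).resolve_left h2]
      · refine ⟨β₁ / α₁, by field_simp, ?_⟩
        field_simp
        linear_combination hdet
    obtain ⟨j, hj⟩ := Int.eq_ofNat_of_zero_le (sub_nonneg.2 hle)
    have hs : algebraMap ℂ K l * x ^ j ∈ O₀ := mul_mem (algebraMap_mem_O₀ l) (pow_mem x_mem j)
    let s : O₀ := ⟨_, hs⟩
    have hsa : s • a = (algebraMap ℂ K l * x ^ j) • a := rfl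
    refine ⟨a, b - s • a, m, n + 1, ⟨?_, ?_, h.left, ?_⟩, by ring⟩
    · rw [h.span]
      apply le_antisymm <;> rw [Submodule.span_le, Set.pair_subset_iff]
      · refine ⟨Submodule.subset_span (by simp), Submodule.mem_span_pair.2 ⟨s, 1, ?_⟩⟩
        rw [one_smul, add_sub_cancel]
      · refine ⟨Submodule.subset_span (by simp), Submodule.mem_span_pair.2 ⟨-s, 1, ?_⟩⟩
        rw [one_smul, neg_smul, neg_add_eq_sub]
    · obtain ⟨c, hc, hd⟩ := h.det
      refine ⟨c, hc, ?_⟩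
      rw [← hd, hsa, map_sub, map_smul]
      simp only [Prod.smul_fst, Prod.smul_snd, smul_eq_mul, Prod.fst_sub, Prod.snd_sub]
      ring
    · have e1 : x ^ (n + 1) • (b - s • a) = x • (x ^ n • b - algebraMap ℂ K l • x ^ m • a) := by
        have : m = n + j := by omega
        rw [hsa, this, zpow_add_one₀ hx, zpow_add₀ hx, zpow_natCast, smul_sub, smul_sub, smul_smul,
          smul_smul, smul_smul, smul_smul]
        congr 2 <;> ring
      rw [e1, he, map_smul, map_sub, map_smul e (algebraMap ℂ K l)]
      simp only [Prod.smul_fst, Prod.smul_snd, smul_eq_mul, Prod.fst_sub, Prod.snd_sub]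
      rw [hα₁, hα₂, hβ₁, hβ₂, hl₁, hl₂, map_mul, map_mul]
      have e2 (α f g : K) : x * (algebraMap ℂ K l * α + x⁻¹ * g - algebraMap ℂ K l *
          (α + x⁻¹ * f)) = g - algebraMap ℂ K l * f := by
        field_simp
        ring
      rw [e2, e2]
      exact ⟨sub_mem hg₁ (mul_mem (Oinf.algebraMap_mem l) hf₁),
        sub_mem hg₂ (mul_mem (Oinf.algebraMap_mem l) hf₂)⟩

/-- Induction on the defect `k = 1 - m - n`; exchanging `a` and `b` reduces each step to the case
where the first exponent is the larger. -/
theorem exists_add_eq_one (he : IsFrameInf E e) (k : ℕ) :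
    ∀ {a b : V} {m n : ℤ}, IsAdapted E e a b m n → m + n + k = 1 →
      ∃ a' b' m' n', IsAdapted E e a' b' m' n' ∧ m' + n' = 1 := by
  induction k with
  | zero => exact fun h hk => ⟨_, _, _, _, h, by simpa using hk⟩
  | succ k ih =>
    intro a b m n h hk
    push_cast at hk
    obtain ⟨a', b', m', n', h', hs⟩ : ∃ a' b' m' n', IsAdapted E e a' b' m' n' ∧
        m' + n' = m + n + 1 := by
      rcases le_total n m with hle | hle
      · exact h.exists_add_one_of_le he (by omega) hle
      · obtain ⟨a', b', m', n', h', hs⟩ := h.symm.exists_add_one_of_le he (by omega) hle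
        exact ⟨a', b', m', n', h', by omega⟩
    exact ih h' (by omega)

/-- When `m + n = 1` the determinant of the rescaled sections at `∞` is a nonzero constant, so
Cramer's rule inverts their matrix within the functions regular at `∞`. The sections are therefore a
frame on both charts. -/
theorem nonempty_iso (he : IsFrameInf E e) (h : IsAdapted E e a b m n) (hmn : m + n = 1) :
    Nonempty (E.Iso (splitBundle m n)) := by
  let f : K × K →ₗ[K] V :=
    (LinearMap.toSpanSingleton K V a).coprod (LinearMap.toSpanSingleton K V b)
  have hf (z : K × K) : f z = z.1 • a + z.2 • b := rfl
  obtain ⟨c, hc, hd⟩ := h.det_smul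
  rw [hmn, sub_self, zpow_zero, mul_one] at hd
  have hcK : algebraMap ℂ K c ≠ 0 := by simpa using hc
  have hx := x_ne_zero
  obtain ⟨ha₁, ha₂⟩ := (he _).1 h.left
  obtain ⟨hb₁, hb₂⟩ := (he _).1 h.right
  have hfs (z : K × K) : f z = (x ^ (-m) * z.1) • x ^ m • a + (x ^ (-n) * z.2) • x ^ n • b := by
    rw [hf, smul_smul, smul_smul, zpow_neg, zpow_neg, mul_right_comm, mul_right_comm _ z.2,
      inv_mul_cancel₀ (zpow_ne_zero _ hx), inv_mul_cancel₀ (zpow_ne_zero _ hx), one_mul, one_mul]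
  have hef₁ (z : K × K) : (e (f z)).1 =
      x ^ (-m) * z.1 * (e (x ^ m • a)).1 + x ^ (-n) * z.2 * (e (x ^ n • b)).1 := by
    rw [hfs, map_add, map_smul e (x ^ (-m) * z.1), map_smul e (x ^ (-n) * z.2)]
    rfl
  have hef₂ (z : K × K) : (e (f z)).2 =
      x ^ (-m) * z.1 * (e (x ^ m • a)).2 + x ^ (-n) * z.2 * (e (x ^ n • b)).2 := by
    rw [hfs, map_add, map_smul e (x ^ (-m) * z.1), map_smul e (x ^ (-n) * z.2)]
    rfl
  generalize (e (x ^ m • a)).1 = A₁ at *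
  generalize (e (x ^ m • a)).2 = A₂ at *
  generalize (e (x ^ n • b)).1 = B₁ at *
  generalize (e (x ^ n • b)).2 = B₂ at *
  have hcr₁ (z : K × K) :
      x ^ (-m) * z.1 = algebraMap ℂ K c⁻¹ * ((e (f z)).1 * B₂ - (e (f z)).2 * B₁) := by
    rw [map_inv₀, eq_inv_mul_iff_mul_eq₀ hcK, hef₁, hef₂, ← hd]
    ring
  have hcr₂ (z : K × K) :
      x ^ (-n) * z.2 = algebraMap ℂ K c⁻¹ * ((e (f z)).2 * A₁ - (e (f z)).1 * A₂) := by
    rw [map_inv₀, eq_inv_mul_iff_mul_eq₀ hcK, hef₁, hef₂, ← hd]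
    ring
  have hinj : Function.Injective f := by
    rw [injective_iff_map_eq_zero]
    intro z hz
    have h₁ := hcr₁ z
    have h₂ := hcr₂ z
    rw [hz, map_zero] at h₁ h₂
    simp only [Prod.fst_zero, Prod.snd_zero, zero_mul, sub_zero, mul_zero] at h₁ h₂
    exact Prod.ext ((mul_eq_zero.1 h₁).resolve_left (zpow_ne_zero _ hx))
      ((mul_eq_zero.1 h₂).resolve_left (zpow_ne_zero _ hx))
  have hsurj : Function.Surjective f := by
    have h1 : Function.Surjective (e.toLinearMap ∘ₗ f) :=
      LinearMap.injective_iff_surjective.1 (e.injective.comp hinj)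
    intro v
    obtain ⟨z, hz⟩ := h1 (e v)
    exact ⟨z, e.injective hz⟩
  let g := LinearEquiv.ofBijective f ⟨hinj, hsurj⟩
  have hg (z : K × K) : g z = f z := rfl
  refine ⟨{ toEquiv := g.symm, mem₀ := fun v => ?_, memInf := fun v => ?_ }⟩
  · obtain ⟨z, rfl⟩ := g.surjective v
    rw [LinearEquiv.symm_apply_apply, h.span, hg, Submodule.mem_span_pair]
    refine (and_congr mem_lineBundle₀ mem_lineBundle₀ : _ ↔ z.1 ∈ O₀ ∧ z.2 ∈ O₀).trans ?_
    constructor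
    · exact fun h => ⟨⟨_, h.1⟩, ⟨_, h.2⟩, rfl⟩
    · rintro ⟨p, q, hpq⟩
      have : ((p : K), (q : K)) = z := hinj hpq
      rw [← this]
      exact ⟨p.2, q.2⟩
  · obtain ⟨z, rfl⟩ := g.surjective v
    rw [LinearEquiv.symm_apply_apply, he, hg]
    refine (and_congr mem_lineBundleInf mem_lineBundleInf :
      _ ↔ x ^ (-m) * z.1 ∈ Oinf ∧ x ^ (-n) * z.2 ∈ Oinf).trans ?_
    constructor
    · rintro ⟨h₁, h₂⟩
      rw [hef₁, hef₂]
      exact ⟨add_mem (mul_mem h₁ ha₁) (mul_mem h₂ hb₁), add_mem (mul_mem h₁ ha₂) (mul_mem h₂ hb₂)⟩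
    · rintro ⟨h₁, h₂⟩
      rw [hcr₁, hcr₂]
      exact ⟨mul_mem (Oinf.algebraMap_mem _) (sub_mem (mul_mem h₁ hb₂) (mul_mem h₂ hb₁)),
        mul_mem (Oinf.algebraMap_mem _) (sub_mem (mul_mem h₂ ha₁) (mul_mem h₁ ha₂))⟩

end IsAdapted

/-- A bundle of rank two and degree one is isomorphic to `𝒪(m) ⊕ 𝒪(1 - m)` for some `m ≤ 0`. -/
theorem exists_splitting (hV : Module.finrank K V = 2) (hE : E.HasDegree 1) :
    ∃ m n : ℤ, m + n = 1 ∧ m < n ∧ Nonempty (E.Iso (splitBundle m n)) := by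
  rw [Bundle.HasDegree, hV] at hE
  obtain ⟨b₀, bInf, h₀, hInf, c, hc, hdet⟩ := hE
  let e : V ≃ₗ[K] K × K := bInf.equivFun.trans (LinearEquiv.finTwoArrow K K)
  have hA {A : Subalgebra ℂ K} {z : K} : z ∈ Set.range (algebraMap A K) ↔ z ∈ A := by
    constructor
    · rintro ⟨a, rfl⟩
      exact a.2
    · exact fun h => ⟨⟨z, h⟩, rfl⟩
  have he : IsFrameInf E e := fun v => by
    rw [← hInf, bInf.mem_span_iff_repr_mem Oinf, Fin.forall_fin_two, hA, hA]
    rfl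
  -- The degree is defined by the determinant of the frame at `∞` in the finite frame; the reduction
  -- uses the inverse one, whence `x⁻¹`.
  have hdet' : bInf.det b₀ = algebraMap ℂ K c⁻¹ * x⁻¹ := by
    have h1 : b₀.det bInf * bInf.det b₀ = 1 := by
      rw [Module.Basis.det_apply, Module.Basis.det_apply, ← Matrix.det_mul,
        b₀.toMatrix_mul_toMatrix_flip, Matrix.det_one]
    rw [hdet, zpow_one] at h1
    rw [map_inv₀, ← mul_inv]
    exact eq_inv_of_mul_eq_one_right h1
  have hmem (i : Fin 2) : b₀ i ∈ E.M₀ := h₀ ▸ Submodule.subset_span ⟨i, rfl⟩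
  obtain ⟨k, hk⟩ := E.glue₀ _ (hmem 0)
  obtain ⟨l, hl⟩ := E.glue₀ _ (hmem 1)
  have had : IsAdapted E e (b₀ 0) (b₀ 1) (-k) (-l) := by
    refine ⟨?_, ⟨c⁻¹, inv_ne_zero hc, ?_⟩, ?_, ?_⟩
    · rw [← h₀]
      congr 1
      ext v
      simp [Fin.exists_fin_two, eq_comm]
    · rw [← hdet', Module.Basis.det_apply, Matrix.det_fin_two]
      simp only [Module.Basis.toMatrix_apply]
      change bInf.repr (b₀ 0) 0 * bInf.repr (b₀ 1) 1 - bInf.repr (b₀ 0) 1 * bInf.repr (b₀ 1) 0 = _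
      ring
    · rwa [zpow_neg, zpow_natCast, ← inv_pow]
    · rwa [zpow_neg, zpow_natCast, ← inv_pow]
  -- The gluing exponents give the start `(-k, -l)`, whose defect is `1 + k + l`.
  obtain ⟨a, b, m, n, h, hmn⟩ := IsAdapted.exists_add_eq_one he (1 + k + l) had (by push_cast; ring)
  rcases lt_or_ge m n with hlt | hge
  · exact ⟨m, n, hmn, hlt, h.nonempty_iso he hmn⟩
  · exact ⟨n, m, by omega, by omega, h.symm.nonempty_iso he (by omega)⟩

end

section

variable {V : Type*} [AddCommGroup V] [Module K V] [Module ℂ V] [IsScalarTower ℂ K V]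
variable {E : Bundle V} {m n : ℤ} {N : ℕ}

/-! ### Residues of logarithmic connections -/

/-- The equation of the divisor of poles near `∞`. -/
def poleInf (t : Fin N → ℂ) : K := ∏ i, (1 - algebraMap ℂ K (t i) * x⁻¹)

theorem one_sub_mem (c : ℂ) : 1 - algebraMap ℂ K c * x⁻¹ ∈ Oinf :=
  sub_mem (one_mem _) (mul_mem (Oinf.algebraMap_mem c) x_inv_mem)

theorem poleInf_mem (t : Fin N → ℂ) : poleInf t ∈ Oinf := prod_mem fun i _ => one_sub_mem (t i)

/-- The divisor `D` avoids `∞`, and its equation is normalised to have value `1` there. -/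
theorem poleInf_eq (t : Fin N → ℂ) : ∃ b ∈ Oinf, poleInf t = 1 + x⁻¹ * b := by
  refine Finset.prod_induction _ (fun z => ∃ b ∈ Oinf, z = 1 + x⁻¹ * b) ?_
    ⟨0, zero_mem _, by simp⟩ fun i _ => ⟨-algebraMap ℂ K (t i),
      neg_mem (Oinf.algebraMap_mem _), by ring⟩
  rintro _ _ ⟨a, ha, rfl⟩ ⟨b, hb, rfl⟩
  exact ⟨a + b + x⁻¹ * a * b, add_mem (add_mem ha hb) (mul_mem (mul_mem x_inv_mem ha) hb), by ring⟩

theorem poleInf_mul_pow (t : Fin N → ℂ) : poleInf t * x ^ N = ∏ i, xSub (t i) := by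
  have : x ^ N = ∏ _i : Fin N, x := by simp
  rw [poleInf, this, ← Finset.prod_mul_distrib]
  refine Finset.prod_congr rfl fun i _ => ?_
  rw [xSub]
  field_simp [x_ne_zero]

theorem residue_value {t : Fin N → ℂ} (D : LogConnection t E) (i : Fin N) (s : E.sec₀) :
    D.residue i (E.value (t i) s) =
      (∏ j ∈ Finset.univ.erase i, (t i - t j))⁻¹ • E.value (t i) (D.coeff s) := rfl

theorem prod_sub_ne_zero {t : Fin N → ℂ} (ht : Function.Injective t) (i : Fin N) :
    ∏ j ∈ Finset.univ.erase i, (t i - t j) ≠ 0 :=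
  Finset.prod_ne_zero_iff.2 fun _ hj =>
    sub_ne_zero.2 fun e => (Finset.ne_of_mem_erase hj) (ht e).symm

/-- The residue theorem for the first summand of a splitting. -/
theorem sum_residue_fst {t : Fin (N + 1) → ℂ} (ht : Function.Injective t)
    (ψ : E.Iso (splitBundle m n)) (D : LogConnection t E) :
    ∑ i, (ψ.coord (t i) (D.residue i (E.value (t i) (ψ.sect (1, 0))))).1 = ((-m : ℤ) : ℂ) := by
  have hx := x_ne_zero
  obtain ⟨⟨g, h⟩, hgh⟩ := ψ.sect.surjective (D.coeff (ψ.sect (1, 0)))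
  obtain ⟨g, hg⟩ := g
  obtain ⟨p, rfl⟩ := mem_O₀_iff.1 hg
  have hres (i : Fin (N + 1)) :
      (ψ.coord (t i) (D.residue i (E.value (t i) (ψ.sect (1, 0))))).1 =
        p.eval (t i) / ∏ j ∈ Finset.univ.erase i, (t i - t j) := by
    rw [residue_value, ← hgh, map_smul, ψ.coord_value, Prod.smul_fst, ev_polynomial, smul_eq_mul,
      mul_comm, div_eq_mul_inv]
  let v := ψ.toEquiv.symm (1, 0)
  have hω : (∏ i, xSub (t i)) * (ψ.toEquiv (D.nabla v)).1 = algebraMap (Polynomial ℂ) K p := by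
    have h1 : (∏ i, xSub (t i)) • D.nabla v = (ψ.sect (⟨_, hg⟩, h) : V) :=
      congrArg Subtype.val hgh.symm
    have h2 := congrArg (fun w => (ψ.toEquiv w).1) h1
    simpa only [map_smul, ψ.toEquiv_sect, Prod.smul_fst, smul_eq_mul] using h2
  have hinf : x ^ m • v ∈ E.Minf := by
    rw [ψ.memInf_iff, map_smul, LinearEquiv.apply_symm_apply]
    simp [zpow_ne_zero _ hx, one_mem, zero_mem]
  have hlog := (ψ.memInf_iff.1 (D.logInf _ hinf)).1
  rw [D.leibniz, ddx_zpow, map_smul, map_smul, map_add, map_smul, map_smul,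
    LinearEquiv.apply_symm_apply] at hlog
  simp only [Prod.smul_fst, smul_eq_mul, Prod.fst_add, mul_one] at hlog
  change x ^ (-m) * (poleInf t * _) ∈ Oinf at hlog
  obtain ⟨b, hb, hb'⟩ := poleInf_eq t
  rw [← poleInf_mul_pow] at hω
  -- The first component of `∇ v` is `p dx / ∏ (x - tᵢ)`, and passing to the frame `x ^ m` at `∞`
  -- adds `m dx / x`. Regularity of the sum at `∞` says that `p + m x ^ N` has degree at most `N -
  -- 1`. As there are `N + 1` poles, this determines the coefficient of `x ^ N` in `p`, which is the
  -- sum of the residues.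
  have hmem : x ^ (-((N : ℤ) - 1)) * algebraMap (Polynomial ℂ) K
      (p + Polynomial.C (m : ℂ) * Polynomial.X ^ N) ∈ Oinf := by
    have hmK : algebraMap (Polynomial ℂ) K (Polynomial.C (m : ℂ)) = (m : K) := by
      rw [map_intCast (Polynomial.C : ℂ →+* Polynomial ℂ), map_intCast]
    have e : x ^ (-((N : ℤ) - 1)) * algebraMap (Polynomial ℂ) K
        (p + Polynomial.C (m : ℂ) * Polynomial.X ^ N) =
        -(x ^ (-m) * (poleInf t * (-x ^ 2 * (x ^ m * (ψ.toEquiv (D.nabla v)).1 +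
          m * x ^ m * x⁻¹)))) - m * b := by
      rw [map_add, map_mul, map_pow, RatFunc.algebraMap_X, hmK, ← hω, zpow_neg x m]
      have hN : x ^ (-((N : ℤ) - 1)) = x * (x ^ N)⁻¹ := by
        rw [neg_sub, sub_eq_add_neg, zpow_add₀ hx, zpow_one, zpow_neg, zpow_natCast]
      have hxm : x ^ m ≠ 0 := zpow_ne_zero _ hx
      have hbb : (m : K) * b = m * (x * (poleInf t - 1)) := by
        rw [hb']
        field_simp
        ring
      rw [hN, hbb]
      field_simp
      ring
    rw [e]
    exact sub_mem (neg_mem hlog) (mul_mem (intCast_mem _ m) hb)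
  have hcoeff : p.coeff N = -m := by
    have h0 : (p + Polynomial.C (m : ℂ) * Polynomial.X ^ N).coeff N = 0 := by
      by_cases hp : p + Polynomial.C (m : ℂ) * Polynomial.X ^ N = 0
      · rw [hp, Polynomial.coeff_zero]
      · have := natDegree_le_of_mem hp hmem
        exact Polynomial.coeff_eq_zero_of_natDegree_lt (by omega)
    rw [Polynomial.coeff_add, Polynomial.coeff_C_mul, Polynomial.coeff_X_pow_self, mul_one] at h0
    exact eq_neg_of_add_eq_zero_left h0
  have hdeg : p.degree < (N + 1 : ℕ) := by
    rw [Polynomial.degree_lt_iff_coeff_zero]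
    intro k hk
    have h0 : (p + Polynomial.C (m : ℂ) * Polynomial.X ^ N).coeff k = 0 := by
      by_cases hp : p + Polynomial.C (m : ℂ) * Polynomial.X ^ N = 0
      · rw [hp, Polynomial.coeff_zero]
      · have := natDegree_le_of_mem hp hmem
        exact Polynomial.coeff_eq_zero_of_natDegree_lt (by omega)
    rwa [Polynomial.coeff_add, Polynomial.coeff_C_mul, Polynomial.coeff_X_pow,
      if_neg (by omega), mul_zero, add_zero] at h0
  -- Lagrange interpolation at `N + 1` nodes expresses the coefficient of `x ^ N` in `p` as `∑ p(tᵢ)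
  -- / ∏_{j ≠ i} (tᵢ - tⱼ)`, the sum of the residues.
  have hL := Lagrange.coeff_eq_sum (s := Finset.univ) (v := t) ht.injOn (P := p)
    (by simpa using hdeg)
  rw [Finset.card_univ, Fintype.card_fin, Nat.add_sub_cancel, hcoeff] at hL
  rw [Finset.sum_congr rfl fun i _ => hres i, ← hL]
  push_cast
  rfl

/-- A decomposable quasi-parabolic bundle has no connection with Kostov-generic residues. -/
theorem not_hasResidues_of_split {t : Fin (N + 1) → ℂ} (ht : Function.Injective t)
    {rp rm : Fin (N + 1) → ℂ} (hr : KostovGeneric rp rm) {P : QuasiParabolic t E}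
    {ψ : E.Iso (splitBundle m n)} {u : Fin (N + 1) → OnePoint ℂ} (hu : HasCoords P ψ u)
    (h : ∀ i, u i = (0 : ℂ) ∨ u i = ∞) (D : LogConnection t E) : ¬ P.HasResidues D rp rm := by
  intro hD
  -- If `Pᵢ` is the first axis, the residue multiplies `(1, 0)` by `rᵢ⁻`. If it is the second axis,
  -- `(1, 0)` represents the quotient by `Pᵢ` and the diagonal entry is `rᵢ⁺`.
  have hσ (i : Fin (N + 1)) : ∃ b : Bool, (if b then rp i else rm i) =
      (ψ.coord (t i) (D.residue i (E.value (t i) (ψ.sect (1, 0))))).1 := by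
    have hc : ψ.coord (t i) (E.value (t i) (ψ.sect (1, 0))) = (1, 0) := by simp
    rcases h i with hi | hi
    · refine ⟨false, ?_⟩
      rw [(hD i).2.1 _ ((hu i _).2 (by rw [hi, mem_ell_coe, hc]; simp)), map_smul, hc]
      simp
    · refine ⟨true, ?_⟩
      have h1 := (hD i).2.2 (E.value (t i) (ψ.sect (1, 0)))
      rw [← map_smul, ← sub_eq_zero, ← map_sub, ← LinearMap.mem_ker, Submodule.ker_mkQ, hu i, hi,
        mem_ell_infty, map_sub, map_smul, hc, Prod.fst_sub, sub_eq_zero] at h1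
      rw [h1]
      simp
  choose σ hσ using hσ
  exact hr σ (-m) (by rw [Finset.sum_congr rfl fun i _ => hσ i, sum_residue_fst ht])

/-! ### Logarithmic connections with given residues -/

/-- The function with simple poles at the `t i` and residues `r i`. -/
def polar (t r : Fin N → ℂ) : K := ∑ i, algebraMap ℂ K (r i) * (xSub (t i))⁻¹

theorem xSub_ne_zero (c : ℂ) : xSub c ≠ 0 := by
  have := RatFunc.algebraMap_ne_zero (Polynomial.X_sub_C_ne_zero c)
  rwa [map_sub, RatFunc.algebraMap_X] at this

/-- Clearing denominators gives a polynomial; at `tᵢ` only the term of the `i`-th pole survives. -/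
theorem exists_polar_eq (t r : Fin N → ℂ) : ∃ g : O₀, (g : K) = (∏ i, xSub (t i)) * polar t r ∧
    ∀ i, ev (t i) g = r i * ∏ j ∈ Finset.univ.erase i, (t i - t j) := by
  refine ⟨∑ i, r i • ∏ j ∈ Finset.univ.erase i, (X₀ - algebraMap ℂ O₀ (t j)), ?_, fun i => ?_⟩
  · rw [polar, Finset.mul_sum, AddSubmonoidClass.coe_finsetSum]
    refine Finset.sum_congr rfl fun i _ => ?_
    rw [← Finset.mul_prod_erase Finset.univ (fun j => xSub (t j)) (Finset.mem_univ i),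
      SetLike.val_smul, Algebra.smul_def, SubmonoidClass.coe_finsetProd]
    have h := xSub_ne_zero (t i)
    change algebraMap ℂ K (r i) * ∏ j ∈ Finset.univ.erase i, xSub (t j) = _
    field_simp
  · rw [map_sum, Finset.sum_eq_single i]
    · simp
    · intro k _ hk
      rw [map_smul, map_prod, Finset.prod_eq_zero (Finset.mem_erase.2 ⟨hk.symm, Finset.mem_univ i⟩)
        (by simp), smul_zero]
    · simp

/-- The expansion `1 / (x - t) = y + t y² + t² y³ / (1 - t y)` with `y = x⁻¹`, summed over the
poles. Its first two coefficients are the quantities constrained in `exists_connection`. -/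
theorem poleInf_mul_polar (t r : Fin N → ℂ) : ∃ z ∈ Oinf, poleInf t * polar t r =
    x⁻¹ * algebraMap ℂ K (∑ i, r i) * poleInf t +
      x⁻¹ ^ 2 * algebraMap ℂ K (∑ i, t i * r i) * poleInf t + x⁻¹ ^ 3 * z := by
  refine ⟨∑ i, algebraMap ℂ K (r i) * algebraMap ℂ K (t i) ^ 2 *
    ∏ j ∈ Finset.univ.erase i, (1 - algebraMap ℂ K (t j) * x⁻¹), sum_mem fun i _ => ?_, ?_⟩
  · exact mul_mem (mul_mem (Oinf.algebraMap_mem _) (pow_mem (Oinf.algebraMap_mem _) 2))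
      (prod_mem fun j _ => one_sub_mem (t j))
  · rw [polar, map_sum, map_sum, Finset.mul_sum, Finset.mul_sum, Finset.mul_sum, Finset.sum_mul,
      Finset.mul_sum, Finset.sum_mul, ← Finset.sum_add_distrib, ← Finset.sum_add_distrib]
    refine Finset.sum_congr rfl fun i _ => ?_
    rw [poleInf, ← Finset.mul_prod_erase Finset.univ (fun j => 1 - algebraMap ℂ K (t j) * x⁻¹)
      (Finset.mem_univ i), map_mul]
    have h := xSub_ne_zero (t i)
    have hx := x_ne_zero
    have h1 : 1 - algebraMap ℂ K (t i) * x⁻¹ = x⁻¹ * xSub (t i) := by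
      rw [xSub]
      field_simp
    have h2 : algebraMap ℂ K (t i) = x - xSub (t i) := by
      rw [xSub]
      ring
    rw [h1, h2]
    field_simp
    ring

/-- On `𝒪 ⊕ 𝒪(1)` there are logarithmic connections with given residues, provided the residues
satisfy the conditions for the extension over `∞`. -/
theorem exists_connection {t : Fin N → ℂ} (ht : Function.Injective t)
    (ψ : E.Iso (splitBundle 0 1)) {α β γ δ : Fin N → ℂ} (hα : ∑ i, α i = 0) (hβ : ∑ i, β i = 0)
    (hβ' : ∑ i, t i * β i = 0) (hδ : ∑ i, δ i = -1) :
    ∃ D : LogConnection t E, ∀ i v, ψ.coord (t i) (D.residue i v) =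
      (α i * (ψ.coord (t i) v).1 + β i * (ψ.coord (t i) v).2,
        γ i * (ψ.coord (t i) v).1 + δ i * (ψ.coord (t i) v).2) := by
  have hx := x_ne_zero
  -- The connection is `d` plus a matrix of forms with simple poles. At `∞` the diagonal entry of
  -- `𝒪` must be `O(x⁻²)`, that of `𝒪(1)` must be `-x⁻¹ + O(x⁻²)`, the entry `𝒪(1) → 𝒪` must be
  -- `O(x⁻³)`, and the entry `𝒪 → 𝒪(1)` may be `O(x⁻¹)`. This accounts for one condition on each of
  -- `α` and `δ`, two on `β` and none on `γ`.
  let A : K × K →ₗ[ℂ] K × K :=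
    { toFun := fun z => (ddx z.1 + polar t α * z.1 + polar t β * z.2,
        ddx z.2 + polar t γ * z.1 + polar t δ * z.2)
      map_add' := fun z w => by
        simp only [Prod.fst_add, Prod.snd_add, map_add, Prod.mk_add_mk]
        exact Prod.ext (by ring) (by ring)
      map_smul' := fun c z => by
        simp only [Prod.smul_fst, Prod.smul_snd, Derivation.map_smul, mul_smul_comm, Prod.smul_mk,
          smul_add, RingHom.id_apply] }
  have hAz (z : K × K) : A z = (ddx z.1 + polar t α * z.1 + polar t β * z.2,
    ddx z.2 + polar t γ * z.1 + polar t δ * z.2) := rfl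
  let nabla : V →ₗ[ℂ] V := (ψ.toEquiv.symm.toLinearMap.restrictScalars ℂ) ∘ₗ A ∘ₗ
    (ψ.toEquiv.toLinearMap.restrictScalars ℂ)
  have hnabla (v : V) : ψ.toEquiv (nabla v) = A (ψ.toEquiv v) :=
    ψ.toEquiv.apply_symm_apply _
  obtain ⟨a, ha, ha'⟩ := exists_polar_eq t α
  obtain ⟨b, hb, hb'⟩ := exists_polar_eq t β
  obtain ⟨c, hc, hc'⟩ := exists_polar_eq t γ
  obtain ⟨d, hd, hd'⟩ := exists_polar_eq t δ
  have hQ : ∏ i, xSub (t i) ∈ O₀ := prod_mem fun i _ => xSub_mem (t i)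
  have hev (i : Fin N) : ev (t i) ⟨_, hQ⟩ = 0 := by
    have : (⟨_, hQ⟩ : O₀) = ∏ i, (X₀ - algebraMap ℂ O₀ (t i)) := Subtype.ext (by
      rw [SubmonoidClass.coe_finsetProd]
      rfl)
    rw [this, map_prod, Finset.prod_eq_zero (Finset.mem_univ i) (by simp)]
  have hmul (z : K × K) : (∏ i, xSub (t i)) • A z =
      ((∏ i, xSub (t i)) * ddx z.1 + a * z.1 + b * z.2,
        (∏ i, xSub (t i)) * ddx z.2 + c * z.1 + d * z.2) := by
    rw [ha, hb, hc, hd, hAz, Prod.smul_mk, smul_eq_mul, smul_eq_mul]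
    exact Prod.ext (by ring) (by ring)
  obtain ⟨a₁, ha₁, ha₂⟩ := poleInf_mul_polar t α
  obtain ⟨b₁, hb₁, hb₂⟩ := poleInf_mul_polar t β
  obtain ⟨c₁, hc₁, hc₂⟩ := poleInf_mul_polar t γ
  obtain ⟨d₁, hd₁, hd₂⟩ := poleInf_mul_polar t δ
  have hT := poleInf_mem t
  have hy := x_inv_mem
  have hA (z : ℂ) : algebraMap ℂ K z ∈ Oinf := Oinf.algebraMap_mem z
  let D : LogConnection t E :=
    { nabla := nabla
      leibniz := fun f v => ψ.toEquiv.injective (by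
        rw [hnabla, map_smul, map_add, map_smul ψ.toEquiv, map_smul ψ.toEquiv, hnabla, hAz, hAz]
        simp only [Prod.smul_fst, Prod.smul_snd, Prod.smul_mk, Derivation.leibniz, smul_eq_mul]
        exact Prod.ext (by simp only [Prod.fst_add, Prod.smul_fst, smul_eq_mul]; ring)
          (by simp only [Prod.snd_add, Prod.smul_snd, smul_eq_mul]; ring))
      log₀ := fun v hv => by
        rw [ψ.mem₀_iff] at hv ⊢
        rw [map_smul, hnabla, hmul]
        exact ⟨add_mem (add_mem (mul_mem hQ (ddx_mem hv.1)) (mul_mem a.2 hv.1))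
          (mul_mem b.2 hv.2), add_mem (add_mem (mul_mem hQ (ddx_mem hv.2)) (mul_mem c.2 hv.1))
          (mul_mem d.2 hv.2)⟩
      logInf := fun v hv => by
        rw [ψ.memInf_iff] at hv ⊢
        rw [map_smul, map_smul, hnabla]
        generalize ψ.toEquiv v = z at hv
        obtain ⟨p, q⟩ := z
        obtain ⟨hp, hq⟩ := hv
        simp only [neg_zero, zpow_zero, one_mul, zpow_neg, zpow_one] at hp hq ⊢
        -- `w` is the coordinate with respect to the frame `x` of `𝒪(1)` near `∞`.
        obtain ⟨w, rfl⟩ : ∃ w, q = x * w := ⟨x⁻¹ * q, by field_simp⟩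
        rw [inv_mul_cancel_left₀ hx] at hq
        constructor
        · change poleInf t * (-x ^ 2 * (ddx p + polar t α * p + polar t β * (x * w))) ∈ Oinf
          have e : poleInf t * (-x ^ 2 * (ddx p + polar t α * p + polar t β * (x * w))) =
              -(poleInf t * (x ^ 2 * ddx p) + x ^ 2 * (poleInf t * polar t α) * p +
                x ^ 3 * (poleInf t * polar t β) * w) := by ring
          rw [e, ha₂, hb₂, hα, hβ, hβ', map_zero]
          have e' : poleInf t * (x ^ 2 * ddx p) + x ^ 2 * (x⁻¹ * 0 * poleInf t +
              x⁻¹ ^ 2 * algebraMap ℂ K (∑ i, t i * α i) * poleInf t + x⁻¹ ^ 3 * a₁) * p +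
                x ^ 3 * (x⁻¹ * 0 * poleInf t + x⁻¹ ^ 2 * 0 * poleInf t + x⁻¹ ^ 3 * b₁) * w =
              poleInf t * (x ^ 2 * ddx p) + algebraMap ℂ K (∑ i, t i * α i) * poleInf t * p +
                x⁻¹ * a₁ * p + b₁ * w := by
            field_simp
            ring
          rw [e']
          exact neg_mem (add_mem (add_mem (add_mem (mul_mem hT (ddx_mem_inf hp))
            (mul_mem (mul_mem (hA _) hT) hp)) (mul_mem (mul_mem hy ha₁) hp)) (mul_mem hb₁ hq))
        · change x⁻¹ * (poleInf t * (-x ^ 2 * (ddx (x * w) + polar t γ * p +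
            polar t δ * (x * w)))) ∈ Oinf
          have e : x⁻¹ * (poleInf t * (-x ^ 2 * (ddx (x * w) + polar t γ * p +
              polar t δ * (x * w)))) =
              -(poleInf t * (x ^ 2 * ddx w) + x * poleInf t * w + x * (poleInf t * polar t γ) * p +
                x ^ 2 * (poleInf t * polar t δ) * w) := by
            rw [Derivation.leibniz, ddx_x, smul_eq_mul, smul_eq_mul]
            field_simp
          rw [e, hc₂, hd₂, hδ, map_neg, map_one]
          have e' : poleInf t * (x ^ 2 * ddx w) + x * poleInf t * w + x * (x⁻¹ *
              algebraMap ℂ K (∑ i, γ i) * poleInf t +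
              x⁻¹ ^ 2 * algebraMap ℂ K (∑ i, t i * γ i) * poleInf t + x⁻¹ ^ 3 * c₁) * p +
                x ^ 2 * (x⁻¹ * -1 * poleInf t +
              x⁻¹ ^ 2 * algebraMap ℂ K (∑ i, t i * δ i) * poleInf t + x⁻¹ ^ 3 * d₁) * w =
              poleInf t * (x ^ 2 * ddx w) + algebraMap ℂ K (∑ i, γ i) * poleInf t * p +
                x⁻¹ * algebraMap ℂ K (∑ i, t i * γ i) * poleInf t * p + x⁻¹ * x⁻¹ * c₁ * p +
                algebraMap ℂ K (∑ i, t i * δ i) * poleInf t * w + x⁻¹ * d₁ * w := by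
            field_simp
            ring
          rw [e']
          exact neg_mem (add_mem (add_mem (add_mem (add_mem (add_mem
            (mul_mem hT (ddx_mem_inf hq)) (mul_mem (mul_mem (hA _) hT) hp))
            (mul_mem (mul_mem (mul_mem hy (hA _)) hT) hp))
            (mul_mem (mul_mem (mul_mem hy hy) hc₁) hp))
            (mul_mem (mul_mem (hA _) hT) hq)) (mul_mem (mul_mem hy hd₁) hq)) }
  refine ⟨D, fun i v => ?_⟩
  obtain ⟨⟨g, h⟩, rfl⟩ := ψ.exists_sect (t i) v
  have hcoeff : D.coeff (ψ.sect (g, h)) =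
      ψ.sect (⟨_, hQ⟩ * ⟨_, ddx_mem g.2⟩ + a * g + b * h,
        ⟨_, hQ⟩ * ⟨_, ddx_mem h.2⟩ + c * g + d * h) := Subtype.ext (ψ.toEquiv.injective (by
    rw [ψ.toEquiv_sect]
    change ψ.toEquiv ((∏ i, xSub (t i)) • nabla (ψ.sect (g, h))) = _
    rw [map_smul, hnabla, hmul, ψ.toEquiv_sect]
    rfl))
  have hne := prod_sub_ne_zero ht i
  rw [residue_value, hcoeff, map_smul, ψ.coord_value, ψ.coord_value]
  simp only [map_add, map_mul, hev, ha', hb', hc', hd', zero_mul, zero_add, Prod.smul_mk,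
    smul_eq_mul]
  refine Prod.ext ?_ ?_
  · field_simp
  · field_simp

end

section

variable {V : Type*} [AddCommGroup V] [Module K V] [Module ℂ V] [IsScalarTower ℂ K V]
variable {E : Bundle V} {m n : ℤ} {N : ℕ} {t : Fin N → ℂ}

/-! ### Quasi-parabolic structures in general position -/

/-- Three of the coordinates are finite and not interpolated by an affine function. -/
def IsGeneral (t : Fin N → ℂ) (u : Fin N → OnePoint ℂ) : Prop :=
  ∃ (i j k : Fin N) (a b c : ℂ), u i = a ∧ u j = b ∧ u k = c ∧
    a * (t j - t k) + b * (t k - t i) + c * (t i - t j) ≠ 0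

/-- A greedy choice: any finite value `a` first, then one differing from the constant `a`, then one
off the affine function through the first two. -/
theorem isGeneral_of_not_affine {u : Fin N → OnePoint ℂ}
    (ht : Function.Injective t)
    (h : ∀ c d : ℂ, ∃ i, ∃ a : ℂ, u i = a ∧ c + d * t i ≠ a) : IsGeneral t u := by
  obtain ⟨i, a, hi, -⟩ := h 0 0
  obtain ⟨j, b, hj, hab⟩ := h a 0
  have hij : t i - t j ≠ 0 := by
    refine sub_ne_zero.2 fun e => hab ?_
    obtain rfl := ht e
    rw [zero_mul, add_zero]
    exact OnePoint.coe_injective (hi.symm.trans hj)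
  obtain ⟨k, c, hk, hc⟩ := h (a - (a - b) / (t i - t j) * t i) ((a - b) / (t i - t j))
  refine ⟨i, j, k, a, b, c, hi, hj, hk, fun e => hc ?_⟩
  field_simp
  linear_combination -e

/-- The expression in `IsGeneral` is linear in the values and kills affine functions of `t`. The
factor `l` allows for `α - δ` in the endomorphism relation and for the first component of a section
generating a subbundle. -/
theorem not_isGeneral_of_affine {u : Fin N → OnePoint ℂ} {l c d : ℂ} (hl : l ≠ 0)
    (h : ∀ i, ∀ a : ℂ, u i = a → c + d * t i = l * a) : ¬ IsGeneral t u := by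
  rintro ⟨i, j, k, a, b, e, hi, hj, hk, hne⟩
  refine hne ((mul_eq_zero.1 (?_ : l * _ = 0)).resolve_left hl)
  linear_combination -(t j - t k) * h i a hi - (t k - t i) * h j b hj - (t i - t j) * h k e hk

theorem IsGeneral.exists_triple {u : Fin N → OnePoint ℂ} (h : IsGeneral t u) :
    ∃ (i j k : Fin N) (a b c : ℂ), (i ≠ j ∧ i ≠ k ∧ j ≠ k) ∧ u i = a ∧ u j = b ∧ u k = c ∧
      a * (t j - t k) + b * (t k - t i) + c * (t i - t j) ≠ 0 := by
  obtain ⟨i, j, k, a, b, c, hi, hj, hk, hne⟩ := h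
  refine ⟨i, j, k, a, b, c, ⟨?_, ?_, ?_⟩, hi, hj, hk, hne⟩
  · rintro rfl
    have := OnePoint.coe_injective (hi.symm.trans hj)
    exact hne (by rw [this]; ring)
  · rintro rfl
    have := OnePoint.coe_injective (hi.symm.trans hk)
    exact hne (by rw [this]; ring)
  · rintro rfl
    have := OnePoint.coe_injective (hj.symm.trans hk)
    exact hne (by rw [this]; ring)

/-- Quasi-parabolic structures in general position carry a connection with given residues. -/
theorem exists_hasResidues (ht : Function.Injective t) {rp rm : Fin N → ℂ}
    (hF : FuchsRelation 1 rp rm) {P : QuasiParabolic t E} {ψ : E.Iso (splitBundle 0 1)}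
    {u : Fin N → OnePoint ℂ} (hu : HasCoords P ψ u) (hg : IsGeneral t u) :
    ∃ D : LogConnection t E, P.HasResidues D rp rm := by
  obtain ⟨i, j, k, a, b, c, hi, hj, hk, hne⟩ := hg
  -- `w` is the finite coordinate, with default `0` at `∞`. `ρ` is the upper left entry of the
  -- residue when its upper right entry vanishes: `rm` if the line has a finite coordinate, `rp` if
  -- it is the second axis.
  let w : Fin N → ℂ := fun l => (u l).elim 0 id
  let ρ : Fin N → ℂ := fun l => (u l).elim (rp l) fun _ => rm l
  -- The weights of `β` on `i, j, k` are orthogonal to `1` and to `t`, as extension over `∞`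
  -- demands. `κ` normalises `∑ w β = ∑ ρ`, so that the upper left entries sum to zero; generality
  -- makes the divisor nonzero.
  let κ : ℂ := (∑ l, ρ l) / (a * (t j - t k) + b * (t k - t i) + c * (t i - t j))
  let β : Fin N → ℂ := Pi.single i (κ * (t j - t k)) + Pi.single j (κ * (t k - t i)) +
    Pi.single k (κ * (t i - t j))
  have hsum (z : Fin N → ℂ) : ∑ l, z l * β l =
      κ * (z i * (t j - t k) + z j * (t k - t i) + z k * (t i - t j)) := by
    simp only [β, Pi.add_apply, mul_add, Finset.sum_add_distrib, Pi.single_apply, mul_ite, mul_zero,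
      Finset.sum_ite_eq', Finset.mem_univ, if_true]
    ring
  have hwi : w i = a := by simp only [w, hi, OnePoint.elim_some, id]
  have hwj : w j = b := by simp only [w, hj, OnePoint.elim_some, id]
  have hwk : w k = c := by simp only [w, hk, OnePoint.elim_some, id]
  have hβ : ∑ l, β l = 0 := by
    have := hsum 1
    simp only [Pi.one_apply, one_mul] at this
    rw [this]
    ring
  have hβt : ∑ l, t l * β l = 0 := by
    rw [hsum]
    ring
  have hβw : ∑ l, w l * β l = ∑ l, ρ l := by
    rw [hsum, hwi, hwj, hwk]
    exact div_mul_cancel₀ _ hne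
  have hF' : ∑ l, (rp l + rm l) = -1 := by
    have : ∑ l, (rp l + rm l) + ((1 : ℤ) : ℂ) = 0 := hF
    rw [Int.cast_one] at this
    exact eq_neg_of_add_eq_zero_left this
  -- Each residue matrix has trace `rp + rm`. For a finite coordinate it has eigenvector `(1, w)`
  -- with eigenvalue `rm`; for `∞`, where `w = β = 0`, it is diagonal with entries `rp`, `rm`. The
  -- Fuchs relation gives `∑ δ = -1`.
  obtain ⟨D, hD⟩ := exists_connection ht ψ (α := fun l => ρ l - w l * β l) (β := β)
    (γ := fun l => (rm l - rp l) * w l - w l * β l * w l)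
    (δ := fun l => (rp l + rm l) - ρ l + w l * β l)
    (by rw [Finset.sum_sub_distrib, hβw, sub_self]) hβ hβt
    (by rw [Finset.sum_add_distrib, Finset.sum_sub_distrib, hβw, hF']; ring)
  have hβ' (l : Fin N) (hl : u l = ∞) : β l = 0 := by
    have h1 : l ≠ i := by
      rintro rfl
      exact OnePoint.coe_ne_infty a (hi.symm.trans hl)
    have h2 : l ≠ j := by
      rintro rfl
      exact OnePoint.coe_ne_infty b (hj.symm.trans hl)
    have h3 : l ≠ k := by
      rintro rfl
      exact OnePoint.coe_ne_infty c (hk.symm.trans hl)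
    simp [β, h1, h2, h3]
  refine ⟨D, fun l => ?_⟩
  have hkey : (∀ v ∈ P.line l, D.residue l v = rm l • v) ∧
      ∀ v, D.residue l v - rp l • v ∈ P.line l := by
    have hDl := hD l
    have hul := hu l
    have hβl := hβ' l
    simp only [w, ρ] at hDl
    generalize u l = z at hDl hul hβl
    cases z using OnePoint.rec with
    | infty =>
      simp only [OnePoint.elim_infty] at hDl
      constructor
      · intro v hv
        have h1 := (hul v).1 hv
        rw [mem_ell_infty] at h1
        apply (ψ.coord (t l)).injective
        rw [hDl, map_smul, h1, hβl rfl]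
        exact Prod.ext (by simp [h1]) (by simp)
      · intro v
        rw [hul, mem_ell_infty, map_sub, map_smul, hDl, hβl rfl]
        simp
    | coe z =>
      simp only [OnePoint.elim_some, id] at hDl
      constructor
      · intro v hv
        have h1 := (hul v).1 hv
        rw [mem_ell_coe] at h1
        apply (ψ.coord (t l)).injective
        rw [hDl, map_smul, h1]
        refine Prod.ext ?_ ?_
        · simp only [Prod.smul_fst, smul_eq_mul]
          ring
        · simp only [Prod.smul_snd, smul_eq_mul, h1]
          ring
      · intro v
        rw [hul, mem_ell_coe, map_sub, map_smul, hDl]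
        simp only [Prod.smul_fst, Prod.smul_snd, Prod.fst_sub, Prod.snd_sub, smul_eq_mul]
        ring
  refine ⟨fun v hv => ?_, hkey.1, fun v => ?_⟩
  · rw [hkey.1 v hv]
    exact Submodule.smul_mem _ _ hv
  · rw [← map_smul, ← sub_eq_zero, ← map_sub, ← LinearMap.mem_ker, Submodule.ker_mkQ]
    exact hkey.2 v

/-- Quasi-parabolic structures in general position are simple. -/
theorem simple_of_isGeneral {P : QuasiParabolic t E}
    {ψ : E.Iso (splitBundle 0 1)} {u : Fin N → OnePoint ℂ} (hu : HasCoords P ψ u)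
    (hg : IsGeneral t u) : P.Simple := by
  intro φ hφ
  have hx := x_ne_zero
  let Φ : K × K →ₗ[K] K × K := ψ.toEquiv.toLinearMap ∘ₗ φ.toLin ∘ₗ ψ.toEquiv.symm.toLinearMap
  have hΦ (z : K × K) : Φ z = ψ.toEquiv (φ.toLin (ψ.toEquiv.symm z)) := rfl
  have hΦ₀ (z : K × K) (h₁ : z.1 ∈ O₀) (h₂ : z.2 ∈ O₀) : (Φ z).1 ∈ O₀ ∧ (Φ z).2 ∈ O₀ :=
    ψ.mem₀_iff.1 (φ.map₀ _ (ψ.mem₀_iff.2 (by simpa using ⟨h₁, h₂⟩)))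
  have hΦinf (z : K × K) (h₁ : z.1 ∈ Oinf) (h₂ : x⁻¹ * z.2 ∈ Oinf) :
      (Φ z).1 ∈ Oinf ∧ x⁻¹ * (Φ z).2 ∈ Oinf := by
    have := ψ.memInf_iff.1 (φ.mapInf (ψ.toEquiv.symm z) (ψ.memInf_iff.2 (by
      simpa using ⟨h₁, h₂⟩)))
    rw [hΦ]
    simpa using this
  have hx01 : ((0, x) : K × K) = x • (0, 1) := by simp
  -- The matrix entries are morphisms of line bundles: constants for `𝒪 → 𝒪` and `𝒪(1) → 𝒪(1)`,
  -- affine for `𝒪 → 𝒪(1)`, zero for `𝒪(1) → 𝒪`.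
  obtain ⟨hA₀, hC₀⟩ := hΦ₀ (1, 0) (one_mem _) (zero_mem _)
  obtain ⟨hB₀, hD₀⟩ := hΦ₀ (0, 1) (zero_mem _) (one_mem _)
  obtain ⟨hA, hC⟩ := hΦinf (1, 0) (one_mem _) (by simp [zero_mem])
  obtain ⟨hB, hD⟩ := hΦinf (0, x) (zero_mem _) (by simp [hx, one_mem])
  rw [hx01, map_smul, Prod.smul_fst, smul_eq_mul] at hB
  rw [hx01, map_smul, Prod.smul_snd, smul_eq_mul, inv_mul_cancel_left₀ hx] at hD
  obtain ⟨α, hα⟩ := eq_const_of_mem hA₀ hA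
  obtain ⟨δ, hδ⟩ := eq_const_of_mem hD₀ hD
  obtain ⟨c, d, hcd⟩ := eq_affine_of_mem hC₀ hC
  have hB' := eq_zero_of_mem hB₀ hB
  have hΦz (z : K × K) : Φ z = (algebraMap ℂ K α * z.1,
      (algebraMap ℂ K c + algebraMap ℂ K d * x) * z.1 + algebraMap ℂ K δ * z.2) := by
    have : z = z.1 • (1, 0) + z.2 • (0, 1) := by simp
    conv_lhs => rw [this, map_add, map_smul, map_smul]
    refine Prod.ext ?_ ?_
    · rw [Prod.fst_add, Prod.smul_fst, Prod.smul_fst, hα, hB']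
      simp [mul_comm]
    · rw [Prod.snd_add, Prod.smul_snd, Prod.smul_snd, hcd, hδ]
      simp [mul_comm]
  -- The vector `(1, a)` is sent to `(α, c + d tᵢ + δ a)`, which must again lie on the line of
  -- coordinate `a`.
  have hrel (i : Fin N) (a : ℂ) (hi : u i = a) : c + d * t i = (α - δ) * a := by
    let s := ψ.sect (1, algebraMap ℂ O₀ a)
    have hs : E.value (t i) s ∈ P.line i := by
      rw [hu, hi, mem_ell_coe, ψ.coord_value]
      simp
    have hφs : φ.sections s = ψ.sect (algebraMap ℂ O₀ α,
        algebraMap ℂ O₀ c + algebraMap ℂ O₀ d * X₀ + algebraMap ℂ O₀ δ * algebraMap ℂ O₀ a) := by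
      refine Subtype.ext (ψ.toEquiv.injective ?_)
      rw [ψ.toEquiv_sect]
      change Φ (1, algebraMap ℂ K a) = _
      rw [hΦz]
      refine Prod.ext (mul_one _) ?_
      change (_ + _) * (1 : K) + _ * _ = _
      rw [mul_one]
      rfl
    have h := hφ i _ hs
    rw [Bundle.Iso.fibre_value, hφs, hu, hi, mem_ell_coe, ψ.coord_value] at h
    simp only [map_add, map_mul, AlgHom.commutes, ev_X₀, Algebra.algebraMap_self,
      RingHom.id_apply] at h
    linear_combination h
  have hαδ : α - δ = 0 := by
    by_contra hne
    exact not_isGeneral_of_affine hne hrel hg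
  obtain ⟨i, j, k, a, b, e, hi, hj, hk, hne⟩ := hg
  have h₁ := hrel i a hi
  have h₂ := hrel j b hj
  have h₃ := hrel k e hk
  rw [hαδ, zero_mul] at h₁ h₂ h₃
  -- Now `c + d x` vanishes at three `tᵢ`. These are not all equal, since otherwise the expression
  -- in `IsGeneral` would be zero.
  have hd0 : d = 0 := by
    by_contra hd0
    have h4 : t i = t j := mul_left_cancel₀ hd0 (by linear_combination h₁ - h₂)
    have h5 : t j = t k := mul_left_cancel₀ hd0 (by linear_combination h₂ - h₃)
    exact hne (by rw [h4, h5]; ring)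
  have hc0 : c = 0 := by simpa [hd0] using h₁
  refine ⟨α, fun v => ψ.toEquiv.injective ?_⟩
  have h := hΦz (ψ.toEquiv v)
  rw [hΦ, LinearEquiv.symm_apply_apply] at h
  rw [h, hd0, hc0, ← sub_eq_zero.1 hαδ, ← algebraMap_smul K α v, map_smul]
  exact Prod.ext rfl (by simp)

/-! ### Shears, and the normal form of indecomposable bundles -/

theorem sub_mem_iff_of_mem {A : Subalgebra ℂ K} {f g : K} (hg : g ∈ A) : f - g ∈ A ↔ f ∈ A :=
  ⟨fun h => by simpa using add_mem h hg, fun h => sub_mem h hg⟩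

/-- Shearing `𝒪(m) ⊕ 𝒪(n)` by a morphism `𝒪(m) → 𝒪(n)`. -/
def shear (p : Polynomial ℂ) (hp : (p.natDegree : ℤ) ≤ n - m) :
    (splitBundle m n).Iso (splitBundle m n) where
  toEquiv :=
    { toFun := fun z => (z.1, z.2 - algebraMap (Polynomial ℂ) K p * z.1)
      invFun := fun z => (z.1, z.2 + algebraMap (Polynomial ℂ) K p * z.1)
      map_add' := fun z w => Prod.ext rfl (by
        simp only [Prod.snd_add, Prod.fst_add]
        ring)
      map_smul' := fun c z => Prod.ext rfl (by
        simp only [Prod.smul_snd, Prod.smul_fst, smul_eq_mul, RingHom.id_apply]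
        ring)
      left_inv := fun z => by simp
      right_inv := fun z => by simp }
  mem₀ z := by
    refine (and_congr mem_lineBundle₀ mem_lineBundle₀).trans
      (Iff.trans ?_ (and_congr mem_lineBundle₀ mem_lineBundle₀).symm)
    exact and_congr_right fun h => sub_mem_iff_of_mem (mul_mem (polynomial_mem_O₀ p) h)
  memInf z := by
    refine (and_congr mem_lineBundleInf mem_lineBundleInf).trans
      (Iff.trans ?_ (and_congr mem_lineBundleInf mem_lineBundleInf).symm)
    refine and_congr_right fun h => ?_
    replace h : x ^ (-m) * z.1 ∈ Oinf := h
    have h' := mul_mem (mem_Oinf_of_natDegree_le hp) h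
    have e : x ^ (-(n - m)) * algebraMap (Polynomial ℂ) K p * (x ^ (-m) * z.1) =
        x ^ (-n) * (algebraMap (Polynomial ℂ) K p * z.1) := by
      have : x ^ (-n) = x ^ (-(n - m)) * x ^ (-m) := by
        rw [← zpow_add₀ x_ne_zero]
        congr 1
        ring
      rw [this]
      ring
    rw [e] at h'
    change x ^ (-n) * (z.2 - algebraMap (Polynomial ℂ) K p * z.1) ∈ Oinf ↔ _
    rw [mul_sub]
    exact sub_mem_iff_of_mem h'

theorem coord_trans_shear (ψ : E.Iso (splitBundle m n)) (p : Polynomial ℂ)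
    (hp : (p.natDegree : ℤ) ≤ n - m) (c : ℂ) (v : E.Fibre c) :
    (ψ.trans (shear p hp)).coord c v =
      ((ψ.coord c v).1, (ψ.coord c v).2 - p.eval c * (ψ.coord c v).1) := by
  obtain ⟨⟨g, h⟩, rfl⟩ := ψ.exists_sect c v
  have e : ψ.sect (g, h) =
      (ψ.trans (shear p hp)).sect (g, h - ⟨_, polynomial_mem_O₀ p⟩ * g) := by
    refine Subtype.ext ((ψ.trans (shear p hp)).toEquiv.injective ?_)
    rw [Bundle.Iso.toEquiv_sect]
    change (shear p hp).toEquiv (ψ.toEquiv (ψ.sect (g, h))) = _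
    rw [ψ.toEquiv_sect]
    rfl
  rw [ψ.coord_value, e, Bundle.Iso.coord_value, map_sub, map_mul, ev_polynomial]

/-- If the finite coordinates are interpolated by a morphism `𝒪(m) → 𝒪(n)`, then the
quasi-parabolic bundle is decomposable. -/
theorem not_indecomposable_of_interpolated {P : QuasiParabolic t E}
    {ψ : E.Iso (splitBundle m n)} {u : Fin N → OnePoint ℂ} (hu : HasCoords P ψ u)
    (p : Polynomial ℂ) (hp : (p.natDegree : ℤ) ≤ n - m)
    (h : ∀ i, ∀ a : ℂ, u i = a → p.eval (t i) = a) : ¬ P.Indecomposable := by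
  refine not_indecomposable_of_split (ψ := ψ.trans (shear p hp))
    (u := fun i => (u i).elim ∞ fun _ => ((0 : ℂ) : OnePoint ℂ)) (fun i v => ?_) fun i => ?_
  · rw [hu, coord_trans_shear]
    beta_reduce
    have hi := h i
    generalize u i = z at hi
    cases z using OnePoint.rec with
    | infty => rw [OnePoint.elim_infty, mem_ell_infty, mem_ell_infty]
    | coe a => rw [OnePoint.elim_some, mem_ell_coe, mem_ell_coe, hi a rfl, zero_mul, sub_eq_zero]
  · generalize u i = z
    cases z using OnePoint.rec with
    | infty => exact Or.inr rfl
    | coe a => exact Or.inl rfl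

/-- An indecomposable quasi-parabolic bundle of rank two and degree one with four lines is
`𝒪 ⊕ 𝒪(1)` with lines in general position. -/
theorem exists_isGeneral_of_indecomposable {t : Fin 4 → ℂ} (ht : Function.Injective t)
    (hV : Module.finrank K V = 2) (hE : E.HasDegree 1) {P : QuasiParabolic t E}
    (hP : P.Indecomposable) : ∃ (ψ : E.Iso (splitBundle 0 1)) (u : Fin 4 → OnePoint ℂ),
      HasCoords P ψ u ∧ IsGeneral t u := by
  obtain ⟨m, n, hmn, hlt, ⟨ψ⟩⟩ := exists_splitting hV hE
  obtain ⟨u, hu⟩ := exists_hasCoords P ψ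
  by_cases hm : m = 0
  · obtain rfl := hm
    obtain rfl : n = 1 := by omega
    refine ⟨ψ, u, hu, isGeneral_of_not_affine ht ?_⟩
    by_contra! hcon
    obtain ⟨c, d, hcd⟩ := hcon
    refine not_indecomposable_of_interpolated hu (Polynomial.C d * Polynomial.X + Polynomial.C c)
      ?_ (fun i a hi => ?_) hP
    · have := Polynomial.natDegree_linear_le (a := d) (b := c)
      omega
    · rw [← hcd i a hi]
      simp [add_comm]
  · exfalso
    -- Here `m < 0`, so `n - m = 1 - 2m ≥ 3` and a cubic through four points is an admissible shear.
    -- The value `0` at points with coordinate `∞` is arbitrary, as shears fix the second axis.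
    let p := Lagrange.interpolate Finset.univ t fun i => (u i).elim 0 id
    refine not_indecomposable_of_interpolated hu p ?_ (fun i a hi => ?_) hP
    · have h1 : p.degree < (4 : ℕ) := Lagrange.degree_interpolate_lt _ ht.injOn
      have h2 : p.natDegree < 4 := by
        by_cases hp : p = 0
        · rw [hp]
          simp
        · exact (Polynomial.natDegree_lt_iff_degree_lt hp).2 h1
      omega
    · rw [Lagrange.eval_interpolate_at_node _ ht.injOn (Finset.mem_univ i), hi]
      rfl

end

section

variable {V : Type*} [AddCommGroup V] [Module K V] [Module ℂ V] [IsScalarTower ℂ K V]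
variable {E : Bundle V} {N : ℕ} {t : Fin N → ℂ}

/-! ### Comparison with the coordinates on `𝒪 ⊕ 𝒪(1)` -/

/-- The tautological splitting of `B`. -/
def splitB : B.Iso (splitBundle 0 1) where
  toEquiv := LinearEquiv.refl K (K × K)
  mem₀ _ := Iff.rfl
  memInf _ := Iff.rfl

/-- An isomorphism with `B` as a splitting. -/
def ofIsoB (ψ : E.Iso B) : E.Iso (splitBundle 0 1) := ψ

theorem coord_ofIsoB (ψ : E.Iso B) (c : ℂ) (v : E.Fibre c) :
    (ofIsoB ψ).coord c v = splitB.coord c (ψ.hom.fibre c v) := by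
  obtain ⟨g, rfl⟩ := (ofIsoB ψ).exists_sect c v
  have e : ψ.hom.sections ((ofIsoB ψ).sect g) = splitB.sect g :=
    Subtype.ext ((ofIsoB ψ).toEquiv_sect g)
  rw [Bundle.Iso.fibre_value, e, Bundle.Iso.coord_value, Bundle.Iso.coord_value]

theorem coord_evalB (c : ℂ) (s : GlobalB) :
    splitB.coord c (evalB c s) = (s.1, s.2.1 + c * s.2.2) := by
  have e : globalSection s = splitB.sect (algebraMap ℂ O₀ s.1,
      algebraMap ℂ O₀ s.2.1 + algebraMap ℂ O₀ s.2.2 * X₀) := by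
    refine Subtype.ext (Prod.ext ?_ ?_)
    · change s.1 • (1 : K) + s.2.1 • (0 : K) + s.2.2 • (0 : K) = algebraMap ℂ K s.1
      simp only [Algebra.smul_def, mul_one, mul_zero, add_zero]
    · change s.1 • (0 : K) + s.2.1 • (1 : K) + s.2.2 • x =
        algebraMap ℂ K s.2.1 + algebraMap ℂ K s.2.2 * x
      simp only [Algebra.smul_def, mul_one, mul_zero, zero_add]
  rw [evalB, LinearMap.comp_apply, e, Bundle.Iso.coord_value]
  simp [mul_comm]

theorem value_secE_add (c a : ℂ) : B.value c secE + a • B.value c secF = evalB c (1, a, 0) := by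
  rw [evalB, LinearMap.comp_apply, ← map_smul, ← map_add]
  congr 1
  simp [globalSection]

theorem value_secF (c : ℂ) : B.value c secF = evalB c (0, 1, 0) := by
  rw [evalB, LinearMap.comp_apply]
  congr 1
  simp [globalSection]

theorem mem_coordLine {c : ℂ} {u : OnePoint ℂ} {v : B.Fibre c} :
    v ∈ coordLine c u ↔ splitB.coord c v ∈ ell u := by
  have key (w : B.Fibre c) : v ∈ (ℂ ∙ w) ↔ splitB.coord c v ∈ ℂ ∙ splitB.coord c w := by
    rw [Submodule.mem_span_singleton, Submodule.mem_span_singleton]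
    refine exists_congr fun a => ?_
    rw [← map_smul, (splitB.coord c).injective.eq_iff]
  cases u using OnePoint.rec with
  | infty =>
    change v ∈ (ℂ ∙ B.value c secF) ↔ _
    rw [key, ell_infty_eq, value_secF, coord_evalB]
    simp
  | coe a =>
    change v ∈ (ℂ ∙ (B.value c secE + a • B.value c secF)) ↔ _
    rw [key, ell_coe_eq, value_secE_add, coord_evalB]
    simp

theorem hasCoords_ofIsoB_iff {P : QuasiParabolic t E} {ψ : E.Iso B} {u : Fin N → OnePoint ℂ} :
    HasCoords P (ofIsoB ψ) u ↔
      ∀ i, (P.line i).map (ψ.hom.fibre (t i)) = coordLine (t i) (u i) := by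
  refine forall_congr' fun i => ⟨fun h => ?_, fun h v => ?_⟩
  · ext w
    rw [mem_coordLine]
    constructor
    · rintro ⟨v, hv, rfl⟩
      rw [← coord_ofIsoB]
      exact (h v).1 hv
    · intro hw
      let v := ((ofIsoB ψ).coord (t i)).symm (splitB.coord (t i) w)
      have hv : ψ.hom.fibre (t i) v = w := (splitB.coord (t i)).injective (by
        rw [← coord_ofIsoB, LinearEquiv.apply_symm_apply])
      refine ⟨v, (h v).2 ?_, hv⟩
      rwa [LinearEquiv.apply_symm_apply]
  · rw [coord_ofIsoB, ← mem_coordLine, ← h]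
    constructor
    · exact fun hv => ⟨v, hv, rfl⟩
    · rintro ⟨w, hw, hwv⟩
      have : w = v := ((ofIsoB ψ).coord (t i)).injective (by
        rw [coord_ofIsoB, coord_ofIsoB, hwv])
      rwa [← this]

/-- The subbundle of `B` generated by `e + (c + d x) f`. -/
def affineSub (c d : ℂ) : Submodule K (K × K) :=
  K ∙ ((1, algebraMap ℂ K c + algebraMap ℂ K d * x) : K × K)

theorem affine_mem (c d : ℂ) : algebraMap ℂ K c + algebraMap ℂ K d * x ∈ O₀ :=
  add_mem (algebraMap_mem_O₀ c) (mul_mem (algebraMap_mem_O₀ d) x_mem)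

/-- The first coordinate is the isomorphism with `𝒪`: a multiple `z • (1, c + d x)` is regular, on
either chart, as soon as `z` is, because `c + d x` is a global section of `𝒪(1)`. -/
theorem nonempty_iso_affineSub (c d : ℂ) :
    Nonempty ((B.sub (affineSub c d)).Iso (lineBundle 0)) := by
  have hne : ((1, algebraMap ℂ K c + algebraMap ℂ K d * x) : K × K) ≠ 0 := fun h =>
    one_ne_zero (congrArg Prod.fst h)
  let χ : K ≃ₗ[K] affineSub c d := LinearEquiv.toSpanNonzeroSingleton K (K × K) _ hne
  have hχ (z : K) : ((χ z : affineSub c d) : K × K) =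
      (z, z * (algebraMap ℂ K c + algebraMap ℂ K d * x)) := by
    change z • ((1, algebraMap ℂ K c + algebraMap ℂ K d * x) : K × K) = _
    simp
  refine ⟨{ toEquiv := χ.symm, mem₀ := fun v => ?_, memInf := fun v => ?_ }⟩
  · obtain ⟨z, rfl⟩ := χ.surjective v
    rw [LinearEquiv.symm_apply_apply, mem_lineBundle₀]
    refine Iff.trans ?_ splitB.mem₀_iff.symm
    change _ ↔ ((χ z : affineSub c d) : K × K).1 ∈ O₀ ∧ ((χ z : affineSub c d) : K × K).2 ∈ O₀
    rw [hχ]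
    exact ⟨fun h => ⟨h, mul_mem h (affine_mem c d)⟩, fun h => h.1⟩
  · obtain ⟨z, rfl⟩ := χ.surjective v
    rw [LinearEquiv.symm_apply_apply, mem_lineBundleInf]
    refine Iff.trans ?_ splitB.memInf_iff.symm
    change _ ↔ x ^ (-0 : ℤ) * ((χ z : affineSub c d) : K × K).1 ∈ Oinf ∧
      x ^ (-1 : ℤ) * ((χ z : affineSub c d) : K × K).2 ∈ Oinf
    rw [hχ]
    refine ⟨fun h => ⟨h, ?_⟩, fun h => h.1⟩
    have e : x ^ (-1 : ℤ) * (z * (algebraMap ℂ K c + algebraMap ℂ K d * x)) =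
        x ^ (-0 : ℤ) * z * (algebraMap ℂ K d + algebraMap ℂ K c * x⁻¹) := by
      have hx := x_ne_zero
      simp only [zpow_neg, zpow_one, neg_zero, zpow_zero]
      field_simp
      ring
    change x ^ (-1 : ℤ) * (z * (algebraMap ℂ K c + algebraMap ℂ K d * x)) ∈ Oinf
    rw [e]
    exact mul_mem h (add_mem (Oinf.algebraMap_mem d) (mul_mem (Oinf.algebraMap_mem c) x_inv_mem))

theorem coordLine_le_subFibre_affineSub {c d z a : ℂ} (h : c + d * z = a) :
    coordLine z (a : OnePoint ℂ) ≤ B.subFibre (affineSub c d) z := by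
  change (ℂ ∙ (B.value z secE + a • B.value z secF)) ≤ _
  rw [Submodule.span_singleton_le_iff_mem, mem_subFibre]
  refine ⟨splitB.sect (1, ⟨_, affine_mem c d⟩), Submodule.mem_span_singleton_self _,
    (splitB.coord z).injective ?_⟩
  have e : (⟨_, affine_mem c d⟩ : O₀) = algebraMap ℂ O₀ c + algebraMap ℂ O₀ d * X₀ := rfl
  rw [value_secE_add, coord_evalB, Bundle.Iso.coord_value, e]
  simp [h]

/-- A subbundle isomorphic to `𝒪` meets the fibres of `B` in points with affine coordinate. -/
theorem exists_affine_of_iso {S : Submodule K (K × K)} (χ : (B.sub S).Iso (lineBundle 0)) :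
    ∃ c d l : ℂ, ∀ z a : ℂ, coordLine z (a : OnePoint ℂ) ≤ B.subFibre S z →
      l ≠ 0 ∧ c + d * z = l * a := by
  have hs₀ : χ.toEquiv.symm 1 ∈ (B.sub S).M₀ := by
    rw [← χ.mem₀, LinearEquiv.apply_symm_apply, mem_lineBundle₀]
    exact one_mem _
  have hsInf : χ.toEquiv.symm 1 ∈ (B.sub S).Minf := by
    rw [← χ.memInf, LinearEquiv.apply_symm_apply, mem_lineBundleInf]
    simp [one_mem]
  obtain ⟨hA₀, hC₀⟩ := splitB.mem₀_iff.1 (show ((χ.toEquiv.symm 1 : S) : K × K) ∈ B.M₀ from hs₀)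
  obtain ⟨hA, hC⟩ := splitB.memInf_iff.1
    (show ((χ.toEquiv.symm 1 : S) : K × K) ∈ B.Minf from hsInf)
  rw [neg_zero, zpow_zero, one_mul] at hA
  rw [zpow_neg, zpow_one] at hC
  -- The unit section of `𝒪` becomes a global section `l e + (c + d x) f` of `B`, which generates
  -- the subbundle.
  obtain ⟨l, hl⟩ := eq_const_of_mem hA₀ hA
  obtain ⟨c, d, hcd⟩ := eq_affine_of_mem hC₀ hC
  replace hl : ((χ.toEquiv.symm 1 : S) : K × K).1 = algebraMap ℂ K l := hl
  replace hcd : ((χ.toEquiv.symm 1 : S) : K × K).2 =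
    algebraMap ℂ K c + algebraMap ℂ K d * x := hcd
  refine ⟨c, d, l, fun z a h => ?_⟩
  replace h : (ℂ ∙ (B.value z secE + a • B.value z secF)) ≤ B.subFibre S z := h
  rw [Submodule.span_singleton_le_iff_mem, mem_subFibre] at h
  obtain ⟨s, hs, hval⟩ := h
  have hk : χ.toEquiv ⟨s, hs⟩ ∈ O₀ :=
    mem_lineBundle₀.1 ((χ.mem₀ ⟨s, hs⟩).2 (show (s : K × K) ∈ B.M₀ from s.2))
  let k : O₀ := ⟨_, hk⟩
  have hsk : (s : K × K) = (k : K) • ((χ.toEquiv.symm 1 : S) : K × K) := by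
    have : (⟨s, hs⟩ : S) = (k : K) • χ.toEquiv.symm 1 := by
      rw [← map_smul, smul_eq_mul, mul_one, LinearEquiv.symm_apply_apply]
    exact congrArg Subtype.val this
  have hs' : s = splitB.sect (k * algebraMap ℂ O₀ l,
      k * (algebraMap ℂ O₀ c + algebraMap ℂ O₀ d * X₀)) := by
    refine Subtype.ext (hsk.trans (Prod.ext ?_ ?_))
    · rw [Prod.smul_fst, hl]
      rfl
    · rw [Prod.smul_snd, hcd]
      rfl
  have hc := congrArg (splitB.coord z) hval
  rw [hs', value_secE_add, coord_evalB, Bundle.Iso.coord_value, Prod.mk.injEq] at hc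
  simp only [map_add, map_mul, AlgHom.commutes, ev_X₀, Algebra.algebraMap_self,
    RingHom.id_apply, mul_zero, add_zero] at hc
  obtain ⟨h₁, h₂⟩ := hc
  -- For `l = 0` the subbundle lies in the summand `𝒪(1)`, whose fibre contains no line with finite
  -- coordinate.
  have hl0 : l ≠ 0 := by
    rintro rfl
    simp at h₁
  refine ⟨hl0, ?_⟩
  have hk0 : ev z k ≠ 0 := fun h0 => by simp [h0] at h₁
  apply mul_left_cancel₀ hk0
  linear_combination h₂ - a * h₁

/-- A subbundle isomorphic to `𝒪` containing a line of finite coordinate is the graph of an affine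
function, so the condition on subbundles is non-interpolability. At most one coordinate is `∞`
because three of the four are finite. -/
theorem coordinateCondition_iff {t : Fin 4 → ℂ} (ht : Function.Injective t)
    (P : QuasiParabolic t E) : CoordinateCondition P ↔
      ∃ (ψ : E.Iso (splitBundle 0 1)) (u : Fin 4 → OnePoint ℂ),
        HasCoords P ψ u ∧ IsGeneral t u := by
  constructor
  · rintro ⟨ψ, u, hu, -, hS⟩
    refine ⟨ofIsoB ψ, u, hasCoords_ofIsoB_iff.2 hu, isGeneral_of_not_affine ht ?_⟩
    by_contra! hcon
    obtain ⟨c, d, hcd⟩ := hcon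
    refine hS ⟨affineSub c d, nonempty_iso_affineSub c d, fun i hi => ?_⟩
    obtain ⟨a, ha⟩ := OnePoint.ne_infty_iff_exists.1 hi
    rw [hu i, ← ha]
    exact coordLine_le_subFibre_affineSub (hcd i a ha.symm)
  · rintro ⟨ψ, u, hu, hg⟩
    have hu' : ∀ i, (P.line i).map (Bundle.Iso.hom (F := B) ψ |>.fibre (t i)) =
      coordLine (t i) (u i) := hasCoords_ofIsoB_iff.1 hu
    refine ⟨ψ, u, hu', fun i' j' hi' hj' => ?_, ?_⟩
    · obtain ⟨i, j, k, a, b, c, ⟨hij, hik, hjk⟩, hi, hj, hk, -⟩ := hg.exists_triple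
      have hne {l l' : Fin 4} {z : ℂ} (h : u l = z) (h' : u l' = ∞) : l ≠ l' := by
        rintro rfl
        exact OnePoint.coe_ne_infty z (h.symm.trans h')
      have h1 := hne hi hi'
      have h2 := hne hj hi'
      have h3 := hne hk hi'
      have h4 := hne hi hj'
      have h5 := hne hj hj'
      have h6 := hne hk hj'
      omega
    · rintro ⟨S, ⟨χ⟩, hS⟩
      obtain ⟨c, d, l, hcd⟩ := exists_affine_of_iso χ
      have hle (i : Fin 4) (a : ℂ) (hi : u i = a) : l ≠ 0 ∧ c + d * t i = l * a := by
        refine hcd _ _ ?_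
        rw [← hi, ← hu' i]
        exact hS i (hi ▸ OnePoint.coe_ne_infty a)
      -- One finite coordinate is needed to know that `l ≠ 0`.
      obtain ⟨i, _, _, a, _, _, -, hi, -⟩ := hg.exists_triple
      exact not_isGeneral_of_affine (hle i a hi).1 (fun i a hi => (hle i a hi).2) hg

/-! ### Comparison with the points of the projective plane -/

/-- The functional on `H⁰(B)` whose kernel consists of the sections with value at `c` in the line
with coordinate `u`. -/
def functional (c : ℂ) (u : OnePoint ℂ) : Module.Dual ℂ GlobalB :=
  u.elim (LinearMap.fst ℂ ℂ (ℂ × ℂ)) fun a =>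
    { toFun := fun s => s.2.1 + c * s.2.2 - a * s.1
      map_add' := fun s s' => by
        simp only [Prod.fst_add, Prod.snd_add]
        ring
      map_smul' := fun z s => by
        simp only [Prod.smul_fst, Prod.smul_snd, smul_eq_mul, RingHom.id_apply]
        ring }

theorem functional_infty (c : ℂ) (s : GlobalB) : functional c ∞ s = s.1 := rfl

theorem functional_coe (c a : ℂ) (s : GlobalB) :
    functional c (a : OnePoint ℂ) s = s.2.1 + c * s.2.2 - a * s.1 := rfl

theorem functional_ne_zero (c : ℂ) (u : OnePoint ℂ) : functional c u ≠ 0 := by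
  intro h
  cases u using OnePoint.rec with
  | infty => simpa [functional_infty] using LinearMap.congr_fun h (1, 0, 0)
  | coe a => simpa [functional_coe] using LinearMap.congr_fun h (0, 1, 0)

/-- The point of the projective plane given by the line in `B_c` with coordinate `u`. -/
def planePoint (c : ℂ) (u : OnePoint ℂ) : Plane :=
  Projectivization.mk ℂ (functional c u) (functional_ne_zero c u)

theorem comap_evalB_coordLine (c : ℂ) (u : OnePoint ℂ) :
    (coordLine c u).comap (evalB c) = (functional c u).ker := by
  ext s
  rw [Submodule.mem_comap, mem_coordLine, coord_evalB, LinearMap.mem_ker]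
  cases u using OnePoint.rec with
  | infty => rw [mem_ell_infty, functional_infty]
  | coe a => rw [mem_ell_coe, functional_coe, sub_eq_zero]

/-- The annihilator of the kernel is the range of the transpose of `f`, and the dual of `ℂ` is
spanned by the identity. -/
theorem dualAnnihilator_ker_functional {W : Type*} [AddCommGroup W] [Module ℂ W]
    (f : Module.Dual ℂ W) : f.ker.dualAnnihilator = ℂ ∙ f := by
  rw [← LinearMap.range_dualMap_eq_dualAnnihilator_ker]
  ext g
  rw [Submodule.mem_span_singleton]
  constructor
  · rintro ⟨h, rfl⟩
    refine ⟨h 1, LinearMap.ext fun w => ?_⟩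
    rw [LinearMap.smul_apply, LinearMap.dualMap_apply, smul_eq_mul, mul_comm, ← smul_eq_mul,
      ← map_smul, smul_eq_mul, mul_one]
  · rintro ⟨a, rfl⟩
    exact ⟨a • LinearMap.id, rfl⟩

theorem isPointOf_coordLine {c : ℂ} {u : OnePoint ℂ} {U : Plane} :
    IsPointOf c (coordLine c u) U ↔ U = planePoint c u := by
  rw [IsPointOf, comap_evalB_coordLine, dualAnnihilator_ker_functional, planePoint,
    ← Projectivization.submodule_injective.eq_iff, Projectivization.submodule_mk]

theorem planePoint_eq_origin_iff {c : ℂ} {u : OnePoint ℂ} : planePoint c u = origin ↔ u = ∞ := by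
  constructor
  · intro h
    cases u using OnePoint.rec with
    | infty => rfl
    | coe a =>
      obtain ⟨z, hz⟩ := (Projectivization.mk_eq_mk_iff' ℂ _ _ _ _).1 h
      have := LinearMap.congr_fun hz (0, 1, 0)
      simp [functional_coe] at this
  · rintro rfl
    rfl

/-- The functionals have coordinate vectors `(-a, 1, t₁)`, `(-b, 1, t₂)`, `(-c, 1, t₃)`, whose
determinant is the expression on the right up to sign. -/
theorem isCollinear_planePoint_iff {t₁ t₂ t₃ : ℂ} (h : t₁ ≠ t₂) {a b c : ℂ} :
    Projectivization.IsCollinear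
      {planePoint t₁ (a : OnePoint ℂ), planePoint t₂ (b : OnePoint ℂ),
        planePoint t₃ (c : OnePoint ℂ)} ↔
      a * (t₂ - t₃) + b * (t₃ - t₁) + c * (t₁ - t₂) = 0 := by
  have h' : t₁ - t₂ ≠ 0 := sub_ne_zero.2 h
  constructor
  · rintro ⟨M, hfin, hrank, hM⟩
    by_contra hne
    have hmem {z : ℂ} {u : OnePoint ℂ} (hz : planePoint z u ∈ (M : Set Plane)) :
        functional z u ∈ M.submodule :=
      (Projectivization.Subspace.mem_submodule_iff M (functional_ne_zero z u)).2 hz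
    have h₁ := hmem (hM (by simp : planePoint t₁ (a : OnePoint ℂ) ∈ _))
    have h₂ := hmem (hM (by simp : planePoint t₂ (b : OnePoint ℂ) ∈ _))
    have h₃ := hmem (hM (by simp : planePoint t₃ (c : OnePoint ℂ) ∈ _))
    have hli : LinearIndependent ℂ ![(⟨_, h₁⟩ : M.submodule), ⟨_, h₂⟩, ⟨_, h₃⟩] := by
      rw [Fintype.linearIndependent_iff]
      intro g hg
      rw [Fin.sum_univ_three] at hg
      have hg' (s : GlobalB) : g 0 * functional t₁ (a : OnePoint ℂ) s +
          g 1 * functional t₂ (b : OnePoint ℂ) s + g 2 * functional t₃ (c : OnePoint ℂ) s = 0 :=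
        LinearMap.congr_fun (congrArg Subtype.val hg) s
      have e₁ := hg' (1, 0, 0)
      have e₂ := hg' (0, 1, 0)
      have e₃ := hg' (0, 0, 1)
      simp only [functional_coe, mul_zero, mul_one, zero_add, add_zero, zero_sub, sub_zero]
        at e₁ e₂ e₃
      -- The multipliers are cofactors of the matrix of the three functionals.
      have g₀ : g 0 = 0 := (mul_eq_zero.1 (show _ * g 0 = 0 by
        linear_combination -(t₂ - t₃) * e₁ + (t₃ * b - t₂ * c) * e₂ +
          (c - b) * e₃)).resolve_left hne
      have g₁ : g 1 = 0 := (mul_eq_zero.1 (show _ * g 1 = 0 by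
        linear_combination -(t₃ - t₁) * e₁ + (t₁ * c - t₃ * a) * e₂ +
          (a - c) * e₃)).resolve_left hne
      have g₂ : g 2 = 0 := by rwa [g₀, g₁, zero_add, zero_add] at e₂
      intro i
      fin_cases i
      · exact g₀
      · exact g₁
      · exact g₂
    have := hli.fintype_card_le_finrank
    rw [Fintype.card_fin] at this
    omega
  · intro hdet
    classical
    let s : Finset (Module.Dual ℂ GlobalB) :=
      {functional t₁ (a : OnePoint ℂ), functional t₂ (b : OnePoint ℂ)}
    have hs : functional t₃ (c : OnePoint ℂ) ∈
        Submodule.span ℂ (s : Set (Module.Dual ℂ GlobalB)) := by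
      rw [Finset.coe_pair, Submodule.mem_span_pair]
      -- The barycentric coordinates of `t₃` with respect to `t₁ ≠ t₂`; they are forced by the last
      -- two coordinates of the functionals.
      refine ⟨-(t₂ - t₃) / (t₁ - t₂), -(t₃ - t₁) / (t₁ - t₂), LinearMap.ext fun w => ?_⟩
      simp only [LinearMap.add_apply, LinearMap.smul_apply, functional_coe, smul_eq_mul]
      field_simp
      linear_combination w.1 * hdet
    refine ⟨(Submodule.span ℂ (s : Set (Module.Dual ℂ GlobalB))).projectivization, ?_, ?_, ?_⟩
    · rw [Projectivization.Subspace.submodule.apply_symm_apply]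
      exact Module.Finite.span_finset ℂ s
    · rw [Projectivization.Subspace.submodule.apply_symm_apply]
      exact (finrank_span_finset_le_card s).trans Finset.card_le_two
    · rintro U (rfl | rfl | rfl)
      · exact (Submodule.mk_mem_projectivization_iff _ _).2 (Submodule.subset_span (by simp [s]))
      · exact (Submodule.mk_mem_projectivization_iff _ _).2 (Submodule.subset_span (by simp [s]))
      · exact (Submodule.mk_mem_projectivization_iff _ _).2 hs

/-- A point differs from the origin iff its coordinate is finite, and for three such points
non-colinearity is the inequality in `IsGeneral`. -/
theorem projectiveCondition_iff (ht : Function.Injective t) (P : QuasiParabolic t E) :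
    ProjectiveCondition P ↔
      ∃ (ψ : E.Iso (splitBundle 0 1)) (u : Fin N → OnePoint ℂ),
        HasCoords P ψ u ∧ IsGeneral t u := by
  constructor
  · rintro ⟨ψ, U, hU, i, j, k, hij, -, -, hi, hj, hk, hcol⟩
    obtain ⟨u, hu⟩ := exists_hasCoords P (ofIsoB ψ)
    have hu' := hasCoords_ofIsoB_iff.1 hu
    have hU' (l : Fin N) : U l = planePoint (t l) (u l) := by
      rw [← isPointOf_coordLine, ← hu']
      exact hU l
    have hfin {l : Fin N} (hl : U l ≠ origin) : ∃ a : ℂ, u l = a := by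
      rw [hU', Ne, planePoint_eq_origin_iff] at hl
      obtain ⟨a, ha⟩ := OnePoint.ne_infty_iff_exists.1 hl
      exact ⟨a, ha.symm⟩
    obtain ⟨a, ha⟩ := hfin hi
    obtain ⟨b, hb⟩ := hfin hj
    obtain ⟨c, hc⟩ := hfin hk
    rw [hU', hU', hU', ha, hb, hc, isCollinear_planePoint_iff (ht.ne hij)] at hcol
    exact ⟨ofIsoB ψ, u, hu, i, j, k, a, b, c, ha, hb, hc, hcol⟩
  · rintro ⟨ψ, u, hu, hg⟩
    have hu' : ∀ i, (P.line i).map (Bundle.Iso.hom (F := B) ψ |>.fibre (t i)) =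
      coordLine (t i) (u i) := hasCoords_ofIsoB_iff.1 hu
    obtain ⟨i, j, k, a, b, c, ⟨hij, hik, hjk⟩, hi, hj, hk, hne⟩ := hg.exists_triple
    have horig {l : Fin N} {z : ℂ} (hl : u l = z) : planePoint (t l) (u l) ≠ origin := by
      rw [Ne, planePoint_eq_origin_iff, hl]
      exact OnePoint.coe_ne_infty z
    refine ⟨ψ, fun l => planePoint (t l) (u l), fun l => ?_, i, j, k, hij, hik, hjk,
      horig hi, horig hj, horig hk, ?_⟩
    · rw [hu' l]
      exact isPointOf_coordLine.2 rfl
    · beta_reduce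
      rwa [hi, hj, hk, isCollinear_planePoint_iff (ht.ne hij)]

end

end P1

end

/-! ### The equivalence of the five conditions -/

theorem mainTheorem10 (t : Fin 4 → ℂ) (ht : Function.Injective t)
    (rp rm : Fin 4 → ℂ) (hF : P1.FuchsRelation 1 rp rm) (hr : P1.Nonspecial rp rm)
    {V : Type*} [AddCommGroup V] [Module P1.K V] [Module ℂ V] [IsScalarTower ℂ P1.K V]
    (hV : Module.finrank P1.K V = 2)
    (E : P1.Bundle V) (hE : E.HasDegree 1) (P : P1.QuasiParabolic t E) :
    List.TFAE [
      ∃ D : P1.LogConnection t E, P.HasResidues D rp rm,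
      P.Indecomposable,
      P.Simple,
      P1.CoordinateCondition P,
      P1.ProjectiveCondition P] := by
  have : Nontrivial V := Module.nontrivial_of_finrank_eq_succ hV
  tfae_have 1 → 2 := by
    rintro ⟨D, hD⟩
    refine ⟨inferInstance, fun S₁ S₂ hdec => ?_⟩
    by_contra! hne
    obtain ⟨m, n, ψ, u, hu, h⟩ := P1.exists_split_of_isDecomposition hV hdec hne.1 hne.2
    exact P1.not_hasResidues_of_split ht hr.1 hu h D hD
  tfae_have 2 → 4 := fun h =>
    (P1.coordinateCondition_iff ht P).2 (P1.exists_isGeneral_of_indecomposable ht hV hE h)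
  tfae_have 4 ↔ 5 :=
    (P1.coordinateCondition_iff ht P).trans (P1.projectiveCondition_iff ht P).symm
  tfae_have 4 → 1 := fun h => by
    obtain ⟨ψ, u, hu, hg⟩ := (P1.coordinateCondition_iff ht P).1 h
    exact P1.exists_hasResidues ht hF hu hg
  tfae_have 4 → 3 := fun h => by
    obtain ⟨ψ, u, hu, hg⟩ := (P1.coordinateCondition_iff ht P).1 h
    exact P1.simple_of_isGeneral hu hg
  tfae_have 3 → 2 := P1.indecomposable_of_simple
  tfae_finish
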